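/- For each $n\ge 1$ let $\rho_n\in(0,1]$, and assume that $\rho_n>1-\frac{\log\log n}{18\log n}$ for all large $n$. Let $\theta_1,\theta_2,\dots$ be independent random $n\times n$ matrices such that the columns of each $\theta_t$ are independent centered Gaussian vectors with all variances equal to $1$ and all pairwise covariances equal to $\rho_n$. For $\omega\in\{-1,1\}^n$ put $\omega_0=\omega$ and $\omega_t=\mathrm{sign}(\theta_t\,\omega_{t-1})$ (coordinatewise) for $t\ge 1$. For two inputs $\omega,\eta\in\{-1,1\}^n$, fed into the same network, let $\tilde D_t=\frac1n\,|\{i:\omega_t(i)\ne\eta_t(i)\}|$. (i) Let $T_n$ be positive integers with $T_n\ge(\log n)^{1/4}$ for all large $n$. For every $\delta>0$ and all sufficiently small $\varepsilon>0$, for any inputs $\omega=\omega^{(n)}$, $\eta=\eta^{(n)}$ with $\tilde D_0<\varepsilon^2/2$ for all large $n$, $$\limsup_{n\to\infty}\mathrm P\Big(\{\tilde D_{T_n}>0\}\cup\Big\{\exists\,t\in\{1,\dots,T_n\}:\tilde D_t>\frac{\varepsilon^2}{2}\Big\}\Big)<\delta ,$$ and in particular $$\limsup_{n\to\infty}\mathrm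 P\Big(\exists\,t\ge 1:\tilde D_t>\frac{\varepsilon^2}{2}\Big)<\delta .$$ (ii) Let $h_n:\{-1,1\}^n\to\{-1,1\}$ be Boolean functions, let $T_n\ge 1$ be integers, and let $f_{n,T_n}(\omega)=h_n(\omega_{T_n})$, a random Boolean function. Suppose that either $T_n\ge(\log n)^{1/4}$ for all large $n$, or $(h_n)$ has a sharp threshold at $1/2$, meaning that whenever the bits of $\omega$ are independent and equal to $1$ with probability $p_n$, where $p_n-\frac12$ is bounded away from $0$, then $\mathrm P(h_n(\omega)=\mathrm{sign}(p_n-\frac12))\to1$. Then, with $\omega$ uniform on $\{-1,1\}^n$ and $\omega^\varepsilon$ obtained from $\omega$ by flipping each bit independently with probability $\varepsilon$, both independent of the network, $f_{n,T_n}$ is annealed noise stable, i.e. $$\lim_{\varepsilon\to0}\ \sup_n\ \mathrm P_{f,\omega,\omega^\varepsilon}\big(f_{n,T_n}(\omega)\ne f_{n,T_n}(\omega^\varepsilon)\big)=0,$$ and quenched noise stable, i.e. for every $\delta>0$ there is $\varepsilon>0$ such that for all $n$, with probability at least $1-\delta$ over the choice of $f_{n,T_n}$, one has $\mathrm P_{\omega,\omega^\varepsilon}\big(f_{n,T_n}(\omega)\ne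 f_{n,T_n}(\omega^\varepsilon)\big)<\delta$. -/

import Mathlib

open MeasureTheory ProbabilityTheory Filter Topology

noncomputable section

namespace NoisyNet

/-! ### The cube, Boolean functions and noise

The two-point set `{-1, 1}` is encoded by `Bool`: `true` is `+1` and `false` is `-1`. -/

/-- The discrete cube `{-1, 1}^n`. -/
abbrev Cube (n : ℕ) : Type := Fin n → Bool

/-- Boolean functions `{-1, 1}^n → {-1, 1}`. -/
abbrev BoolFn (n : ℕ) : Type := Cube n → Bool

/-- The numerical value `±1` of a bit. -/
def bit (b : Bool) : ℝ := if b then 1 else -1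

/-- The sign of a real number as a bit. The value at `0` is immaterial, since in the networks below
the sign is only taken of nondegenerate centered Gaussian variables (for `n ≥ 1`). -/
def signBit (x : ℝ) : Bool := decide (0 < x)

/-- The law on `{-1, 1}^n` under which the bits are independent and equal to `+1` with
probability `p`. -/
def bernoulliCube (n : ℕ) (p : unitInterval) : Measure (Cube n) :=
  Measure.pi fun _ => bernoulliMeasure true false p

/-- The uniform law on `{-1, 1}^n`. -/
def uniformCube (n : ℕ) : Measure (Cube n) :=
  bernoulliCube n ⟨1 / 2, by norm_num, by norm_num⟩

/-- The joint law of `(ω, ω^ε)`: `ω` is uniform and `ω^ε` is obtained from `ω` by flipping each bit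
independently with probability `ε`. -/
def noisePair (n : ℕ) (ε : unitInterval) : Measure (Cube n × Cube n) :=
  ((uniformCube n).prod (bernoulliCube n ε)).map
    fun q => (q.1, fun i => xor (q.1 i) (q.2 i))

/-- Annealed noise stability of a sequence `π_n` of laws on Boolean functions:
`lim_{ε → 0} sup_n P_{f, ω, ω^ε} (f ω ≠ f ω^ε) = 0`. -/
def AnnealedNoiseStable (π : ∀ n, Measure (BoolFn n)) : Prop :=
  Tendsto
    (fun ε : unitInterval =>
      ⨆ n, ((π n).prod (noisePair n ε)) {q | q.1 q.2.1 ≠ q.1 q.2.2})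
    (𝓝[>] 0) (𝓝 0)

/-- Quenched noise stability of a sequence `π_n` of laws on Boolean functions: for every `δ > 0`
there is `ε > 0` such that for all `n`,
`π_n {f : P_{ω, ω^ε} (f ω ≠ f ω^ε) < δ} ≥ 1 - δ`. -/
def QuenchedNoiseStable (π : ∀ n, Measure (BoolFn n)) : Prop :=
  ∀ δ : ℝ, 0 < δ → ∃ ε : unitInterval, 0 < ε ∧ ∀ n,
    1 - ENNReal.ofReal δ ≤
      π n {f | noisePair n ε {q | f q.1 ≠ f q.2} < ENNReal.ofReal δ}

/-- A sequence of Boolean functions has a sharp threshold at `1/2`: if the bits of `ω` are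
independent and `+1` with probability `p_n`, where `p_n - 1/2` is bounded away from `0`, then
`P (h_n ω = sign (p_n - 1/2)) → 1`. -/
def SharpThreshold (h : ∀ n, BoolFn n) : Prop :=
  ∀ p : ℕ → unitInterval,
    (∃ c : ℝ, 0 < c ∧ ∀ n, c ≤ |(p n : ℝ) - 1 / 2|) →
    Tendsto (fun n => bernoulliCube n (p n) {ω | h n ω = signBit ((p n : ℝ) - 1 / 2)})
      atTop (𝓝 1)

/-! ### The correlated Gaussian network -/

/-- The Gaussian variables of one layer of width `n`: the family `ν(j)` and the
family `ψ(i, j)`. -/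
abbrev LayerNoise (n : ℕ) : Type := (Fin n → ℝ) × (Fin n → Fin n → ℝ)

/-- All the variables `ν(j)`, `ψ(i, j)` of a layer are independent standard Gaussians. -/
def layerLaw (n : ℕ) : Measure (LayerNoise n) :=
  (Measure.pi fun _ => gaussianReal 0 1).prod
    (Measure.pi fun _ => Measure.pi fun _ => gaussianReal 0 1)

instance (n : ℕ) : IsProbabilityMeasure (layerLaw n) := by
  unfold layerLaw; infer_instance

/-- The law of an infinite sequence of independent layers. -/
def netLaw (n : ℕ) : Measure (ℕ → LayerNoise n) :=
  Measure.infinitePi fun _ => layerLaw n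

/-- The weight matrix `θ(i, j) = √ρ ν(j) + √(1 - ρ) ψ(i, j)`: the columns are independent, and each
column is a centered Gaussian vector with unit variances and all pairwise covariances `ρ`. -/
def weight {n : ℕ} (ρ : ℝ) (z : LayerNoise n) : Matrix (Fin n) (Fin n) ℝ :=
  fun i j => √ρ * z.1 j + √(1 - ρ) * z.2 i j

/-- One layer of the network: `ω ↦ sign (θ ω)`, coordinatewise. -/
def layer {n : ℕ} (ρ : ℝ) (z : LayerNoise n) (ω : Cube n) : Cube n :=
  fun i => signBit (∑ j, weight ρ z i j * bit (ω j))

/-- The state `ω_t` after `t` layers when the input is `ω_0 = ω`; `Θ t` holds the variables of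
layer `t + 1`. -/
def state {n : ℕ} (ρ : ℝ) (Θ : ℕ → LayerNoise n) (ω : Cube n) : ℕ → Cube n
  | 0 => ω
  | t + 1 => layer ρ (Θ t) (state ρ Θ ω t)

/-- The law `π_n` of the random Boolean function `f_{n, T} ω = h ω_T`. -/
def functionLaw (n : ℕ) (ρ : ℝ) (T : ℕ) (h : BoolFn n) : Measure (BoolFn n) :=
  (netLaw n).map fun Θ ω => h (state ρ Θ ω T)

/-- The proportion of coordinates in which two points of the cube disagree. -/
def disagreement {n : ℕ} (ω η : Cube n) : ℝ := (hammingDist ω η : ℝ) / n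

/-- The process of the proportion of disagreements between the layers of one and the same network,
run on the two inputs `ω` and `η`. It starts from `disagreement ω η`. -/
def disagreementProcess {n : ℕ} (ρ : ℝ) (ω η : Cube n) (Θ : ℕ → LayerNoise n) (t : ℕ) : ℝ :=
  disagreement (state ρ Θ ω t) (state ρ Θ η t)

end NoisyNet

end

/-!
Given the common Gaussians `ν` of a layer, each output bit is the sign of a common part, of size
`√ρ |⟨ν, ω⟩| / √n`, plus an individual noise of variance `1 - ρ ≪ 1`, so almost all bits follow the
sign of the common part. If `ω` and `η` disagree in a small proportion of places, their common parts
are close and have the same sign unless they are near `0`. Hence one layer brings the disagreement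
from a small constant to below `a⁻¹⁰`, where `a = (log n) ^ (1 / 8)`, up to small probability.

From then on, a layer takes the disagreement above `a⁻¹⁰` with probability `o(a⁻²)` only, while with
probability at least of order `1 / a` the common part is so large that no bit deviates from its
sign, and the two orbits coalesce for ever. After `a² = (log n) ^ (1 / 4)` layers, coalescence has
occurred with probability `1 - O(exp (-c a))`, and no escape with probability `1 - o(1)`.

For a sharp threshold function at any depth, the disagreement is still small before the last layer,
and this suffices: given `ν`, the bits of the last layer are independent with a bias bounded away
from `1 / 2` in the direction of the common part, so the function returns the sign of the common
part, which is the same for both inputs.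
-/

namespace NoisyNet

/-! ### Product measures and counting -/

section Probability

variable {α β ι : Type*} [MeasurableSpace α] [MeasurableSpace β]

lemma measureReal_prod_le_add_mul (μ : Measure α) (ν : Measure β) [IsProbabilityMeasure μ]
    [IsProbabilityMeasure ν] {s : Set (α × β)} (hs : MeasurableSet s) {a b : Set α}
    (ha : MeasurableSet a) (hb : MeasurableSet b) {c : ℝ} (hc : 0 ≤ c)
    (hsc : ∀ x ∈ b \ a, ν.real (Prod.mk x ⁻¹' s) ≤ c)
    (hs_zero : ∀ x ∉ a ∪ b, ν.real (Prod.mk x ⁻¹' s) = 0) :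
    (μ.prod ν).real s ≤ μ.real a + c * μ.real b := by
  refine ENNReal.toReal_le_of_le_ofReal (by positivity) ?_
  calc μ.prod ν s = ∫⁻ x, ν (Prod.mk x ⁻¹' s) ∂μ := Measure.prod_apply hs
    _ ≤ ∫⁻ x, a.indicator 1 x + b.indicator (fun _ => ENNReal.ofReal c) x ∂μ := by
        refine lintegral_mono fun x => ?_
        by_cases hxa : x ∈ a
        · simpa [hxa] using prob_le_one.trans le_self_add
        by_cases hxb : x ∈ b
        · simpa [hxa, hxb] using (ENNReal.le_ofReal_iff_toReal_le (by finiteness) hc).2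
            (hsc x ⟨hxb, hxa⟩)
        · simpa [hxa, hxb, measureReal_eq_zero_iff] using hs_zero x (by simp [hxa, hxb])
    _ = ENNReal.ofReal (μ.real a + c * μ.real b) := by
        rw [lintegral_add_left (measurable_one.indicator ha), lintegral_indicator_one ha,
          lintegral_indicator_const hb, ENNReal.ofReal_add (by positivity) (by positivity),
          ENNReal.ofReal_mul hc, ofReal_measureReal, ofReal_measureReal]

lemma measureReal_le_card_div_le [Fintype ι] (μ : Measure α) [IsProbabilityMeasure μ]
    {A : ι → Set α} [∀ x, DecidablePred (x ∈ A ·)] (hA : ∀ i, MeasurableSet (A i)) {p v : ℝ}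
    (hp : 0 ≤ p) (hAp : ∀ i, μ.real (A i) ≤ p) (hv : 0 < v) :
    μ.real {x | v ≤ (Finset.univ.filter (x ∈ A ·)).card / (Fintype.card ι : ℝ)} ≤ p / v := by
  have card_eq (x : α) : ((Finset.univ.filter (x ∈ A ·)).card : ℝ) =
      ∑ i, (A i).indicator (fun _ => (1 : ℝ)) x := by
    rw [← Finset.sum_boole]
    exact Finset.sum_congr rfl fun i _ => by simp [Set.indicator_apply]
  have hint (i : ι) : Integrable ((A i).indicator fun _ => (1 : ℝ)) μ :=
    (integrable_const 1).indicator (hA i)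
  have markov := mul_meas_ge_le_integral_of_nonneg (μ := μ)
    (f := fun x => ((Finset.univ.filter (x ∈ A ·)).card : ℝ) / Fintype.card ι)
    (.of_forall fun x => by positivity)
    (by simpa only [card_eq] using (integrable_finsetSum _ fun i _ => hint i).div_const _) v
  rw [le_div_iff₀' hv]
  refine markov.trans ?_
  simp only [card_eq]
  rw [integral_div, integral_finsetSum _ fun i _ => hint i]
  refine div_le_of_le_mul₀ (by positivity) hp ?_
  calc ∑ i, ∫ x, (A i).indicator (fun _ => (1 : ℝ)) x ∂μ = ∑ i, μ.real (A i) :=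
        Finset.sum_congr rfl fun i _ => by rw [integral_indicator_const _ (hA i), smul_eq_mul,
          mul_one]
    _ ≤ ∑ _i : ι, p := Finset.sum_le_sum fun i _ => hAp i
    _ = p * Fintype.card ι := by simp [mul_comm]

lemma measurePreserving_head_tail (μ : Measure α) [IsProbabilityMeasure μ] :
    MeasurePreserving (fun x : ℕ → α => (x 0, fun t => x (t + 1)))
      (Measure.infinitePi fun _ => μ) (μ.prod (Measure.infinitePi fun _ => μ)) := by
  have indep : IndepFun (fun x : ℕ → α => x 0) (fun x t => x (t + 1))
      (Measure.infinitePi fun _ => μ) := by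
    have h := indep_iSup_of_disjoint (fun i => (measurable_pi_apply i).comap_le)
      (iIndepFun_infinitePi (P := fun _ : ℕ => μ) (X := fun _ x => x) fun _ => measurable_id)
      (disjoint_compl_right (a := {0}))
    refine indep_of_indep_of_le_right (indep_of_indep_of_le_left h ?_) ?_
    · exact le_iSup₂_of_le 0 rfl le_rfl
    · rw [MeasurableSpace.pi, MeasurableSpace.comap_iSup]
      exact iSup_le fun t => by
        rw [MeasurableSpace.comap_comp]
        exact le_iSup₂_of_le (t + 1) (by simp) le_rfl
  have tail : (Measure.infinitePi fun _ : ℕ => μ).map (fun x t => x (t + 1)) =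
      Measure.infinitePi fun _ => μ :=
    Measure.map_infinitePi_infinitePi_of_inj (P := fun _ => μ) (add_left_injective 1)
  refine ⟨by fun_prop, ?_⟩
  rw [indep.map_prod_eq_prod_map_map (Measurable.aemeasurable (by fun_prop))
    (Measurable.aemeasurable (by fun_prop)), tail,
    Measure.infinitePi_map_eval (fun _ => μ) 0]

end Probability

lemma eventually_forall_of_forall_seq {α ι : Type*} [Nonempty α] {l : Filter ι}
    {P : ι → α → Prop} (h : ∀ a : ι → α, ∀ᶠ n in l, P n (a n)) : ∀ᶠ n in l, ∀ a, P n a := by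
  filter_upwards [h fun n => Classical.epsilon fun a => ¬ P n a] with n hn a
  exact not_not.1 fun ha => Classical.epsilon_spec (p := fun a => ¬ P n a) ⟨a, ha⟩ hn

/-! ### Gaussian laws -/

lemma gaussianReal_le_mul_volume (m : ℝ) {v : NNReal} (hv : v ≠ 0) (s : Set ℝ) :
    gaussianReal m v s ≤ ENNReal.ofReal (√(2 * Real.pi * v))⁻¹ * volume s := by
  rw [gaussianReal_apply m hv, ← setLIntegral_const]
  refine lintegral_mono fun x => ENNReal.ofReal_le_ofReal ?_
  exact mul_le_of_le_one_right (by positivity)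
    (Real.exp_le_one_iff.2 (div_nonpos_of_nonpos_of_nonneg (by nlinarith) (by positivity)))

lemma gaussianReal_abs_lt_le {y : ℝ} (hy : 0 ≤ y) : (gaussianReal 0 1).real {x | |x| < y} ≤ y := by
  have two_le : (2 : ℝ) ≤ √(2 * Real.pi) :=
    Real.le_sqrt_of_sq_le (by nlinarith [Real.pi_gt_three])
  have interval : {x : ℝ | |x| < y} = Set.Ioo (-y) y := by ext x; simp [abs_lt]
  refine ENNReal.toReal_le_of_le_ofReal hy
    ((gaussianReal_le_mul_volume 0 one_ne_zero _).trans ?_)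
  rw [interval, Real.volume_Ioo, ← ENNReal.ofReal_mul (by positivity), NNReal.coe_one, mul_one]
  refine ENNReal.ofReal_le_ofReal ((inv_mul_le_iff₀ (by positivity)).2 ?_)
  nlinarith

lemma le_gaussianReal_abs_ge {y : ℝ} (hy : 0 ≤ y) :
    (√(2 * Real.pi))⁻¹ * Real.exp (-(y + 1) ^ 2 / 2) ≤ (gaussianReal 0 1).real {x | y ≤ |x|} := by
  refine (ENNReal.ofReal_le_iff_le_toReal (measure_ne_top _ _)).1 ?_
  calc ENNReal.ofReal ((√(2 * Real.pi))⁻¹ * Real.exp (-(y + 1) ^ 2 / 2))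
      = ∫⁻ _ in Set.Icc y (y + 1),
          ENNReal.ofReal ((√(2 * Real.pi))⁻¹ * Real.exp (-(y + 1) ^ 2 / 2)) := by
        rw [setLIntegral_const, Real.volume_Icc, add_sub_cancel_left, ENNReal.ofReal_one, mul_one]
    _ ≤ ∫⁻ x in Set.Icc y (y + 1), gaussianPDF 0 1 x := by
        refine setLIntegral_mono (measurable_gaussianPDF 0 1) fun x hx => ?_
        refine ENNReal.ofReal_le_ofReal ?_
        have sq_le : x ^ 2 ≤ (y + 1) ^ 2 := by nlinarith [hx.1, hx.2]
        simp only [gaussianPDFReal, NNReal.coe_one, mul_one, sub_zero]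
        gcongr
    _ = gaussianReal 0 1 (Set.Icc y (y + 1)) := (gaussianReal_apply 0 one_ne_zero _).symm
    _ ≤ gaussianReal 0 1 {x | y ≤ |x|} := measure_mono fun x hx => hx.1.trans (le_abs_self x)

lemma hasSubgaussianMGF_id_gaussianReal (v : NNReal) :
    HasSubgaussianMGF id v (gaussianReal 0 v) where
  integrable_exp_mul := integrable_exp_mul_gaussianReal
  mgf_le t := by simp [mgf_id_gaussianReal]

lemma gaussianReal_abs_ge_le (v : NNReal) {y : ℝ} (hy : 0 ≤ y) :
    (gaussianReal 0 v).real {x | y ≤ |x|} ≤ 2 * Real.exp (-y ^ 2 / (2 * v)) := by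
  have subgaussian := hasSubgaussianMGF_id_gaussianReal v
  calc (gaussianReal 0 v).real {x | y ≤ |x|}
      ≤ (gaussianReal 0 v).real ({x | y ≤ id x} ∪ {x | y ≤ (-id) x}) :=
        measureReal_mono fun x (hx : y ≤ |x|) => le_abs.1 hx
    _ ≤ Real.exp (-y ^ 2 / (2 * v)) + Real.exp (-y ^ 2 / (2 * v)) :=
        (measureReal_union_le _ _).trans
          (add_le_add (subgaussian.measure_ge_le hy) (subgaussian.neg.measure_ge_le hy))
    _ = 2 * Real.exp (-y ^ 2 / (2 * v)) := (two_mul _).symm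

lemma gaussianReal_abs_gt_le (v : NNReal) {w : ℝ} (hw : 0 < w) :
    (gaussianReal 0 v).real {x | w < |x|} ≤ v / w ^ 2 := by
  have chebyshev := meas_ge_le_variance_div_sq (memLp_id_gaussianReal (μ := 0) (v := v) 2) hw
  rw [variance_id_gaussianReal] at chebyshev
  refine ENNReal.toReal_le_of_le_ofReal (by positivity)
    ((measure_mono fun x hx => ?_).trans chebyshev)
  simpa using hx.le

lemma map_sum_mul_pi_gaussianReal {ι : Type*} [Fintype ι] (c : ι → ℝ) :
    (Measure.pi fun _ : ι => gaussianReal 0 1).map (fun x => ∑ j, x j * c j) =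
      gaussianReal 0 (∑ j, c j ^ 2).toNNReal := by
  have eval (j : ι) := (measurePreserving_eval (fun _ : ι => gaussianReal 0 1) j).hasLaw
  have term (j : ι) := gaussianReal_mul_const (eval j) (c j)
  have gaussian : HasGaussianLaw (fun x : ι → ℝ => ∑ j, x j * c j)
      (Measure.pi fun _ => gaussianReal 0 1) :=
    (iIndepFun_pi (X := fun j x => x * c j) fun j => by fun_prop).hasGaussianLaw_fun_sum
      fun j => (term j).hasGaussianLaw
  have mean : ∫ x, ∑ j, x j * c j ∂Measure.pi (fun _ : ι => gaussianReal 0 1) = 0 := by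
    rw [integral_finsetSum _ fun j _ => (term j).hasGaussianLaw.integrable]
    exact Finset.sum_eq_zero fun j _ => by simp [(term j).integral_eq]
  have variance : Var[fun x => ∑ j, x j * c j; Measure.pi fun _ : ι => gaussianReal 0 1] =
      ∑ j, c j ^ 2 := by
    have sum := variance_sum_pi (μ := fun _ : ι => gaussianReal 0 1) (X := fun j x => x * c j)
      fun j => (memLp_id_gaussianReal 2).mul_const (c j)
    simpa [Finset.sum_fn, variance_mul_const, variance_id_gaussianReal] using sum
  rw [gaussian.map_eq_gaussianReal, mean, variance]

/-! ### One layer of the network -/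

lemma bit_sq (b : Bool) : bit b ^ 2 = 1 := by cases b <;> simp [bit]

lemma measurable_signBit : Measurable signBit := by
  refine measurable_to_bool ?_
  have preimage : signBit ⁻¹' {true} = Set.Ioi 0 := by ext x; simp [signBit]
  exact preimage ▸ measurableSet_Ioi

lemma signBit_mul_of_pos {c : ℝ} (hc : 0 < c) (x : ℝ) : signBit (c * x) = signBit x := by
  simp [signBit, hc]

lemma signBit_eq_of_abs_sub_lt {a b : ℝ} (h : |b - a| < |a|) : signBit b = signBit a := by
  have bounds := abs_lt.1 h
  rw [signBit, signBit, decide_eq_decide]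
  rcases abs_cases a with ⟨ha, _⟩ | ⟨ha, _⟩ <;> rw [ha] at bounds <;>
    constructor <;> intro <;> linarith

lemma disagreement_nonneg {n : ℕ} (ω η : Cube n) : 0 ≤ disagreement ω η := by
  unfold disagreement; positivity

lemma disagreement_self {n : ℕ} (ω : Cube n) : disagreement ω ω = 0 := by
  simp [disagreement]

lemma one_div_le_disagreement {n : ℕ} {ω η : Cube n} (h : ω ≠ η) :
    1 / (n : ℝ) ≤ disagreement ω η := by
  unfold disagreement
  gcongr
  exact_mod_cast hammingDist_pos.2 h

lemma le_abs_and_signBit_eq_of_abs_sub_le {a b u w : ℝ} (hu : 0 < u) (ha : u + w ≤ |a|)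
    (hab : |a - b| ≤ w) : u ≤ |a| ∧ u ≤ |b| ∧ signBit b = signBit a := by
  have w_nonneg : 0 ≤ w := (abs_nonneg _).trans hab
  refine ⟨by linarith, by linarith [abs_sub_abs_le_abs_sub a b], signBit_eq_of_abs_sub_lt ?_⟩
  rw [abs_sub_comm]
  linarith

/-- The scalar product of `x` with the `±1` vector `ω`, normalised so as to be standard Gaussian
when the coordinates of `x` are independent and standard Gaussian. -/
noncomputable def avg {n : ℕ} (ω : Cube n) (x : Fin n → ℝ) : ℝ := ∑ j, x j * (bit (ω j) / √n)

@[fun_prop]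
lemma measurable_avg {n : ℕ} (ω : Cube n) : Measurable (avg ω) := by
  unfold avg; fun_prop

lemma measurePreserving_avg {n : ℕ} (hn : n ≠ 0) (ω : Cube n) :
    MeasurePreserving (avg ω) (Measure.pi fun _ => gaussianReal 0 1) (gaussianReal 0 1) := by
  refine ⟨measurable_avg ω, (map_sum_mul_pi_gaussianReal _).trans ?_⟩
  simp [div_pow, bit_sq, hn]

lemma measurePreserving_avg_sub {n : ℕ} (ω η : Cube n) :
    MeasurePreserving (fun x => avg ω x - avg η x) (Measure.pi fun _ => gaussianReal 0 1)
      (gaussianReal 0 (4 * disagreement ω η).toNNReal) := by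
  have avg_sub : (fun x => avg ω x - avg η x) =
      fun x => ∑ j, x j * ((bit (ω j) - bit (η j)) / √n) := by
    ext x; simp only [avg, ← Finset.sum_sub_distrib, ← mul_sub, sub_div]
  have sq_term (j : Fin n) :
      ((bit (ω j) - bit (η j)) / √n) ^ 2 = 4 * (if ω j ≠ η j then 1 else 0) / n := by
    rw [div_pow, Real.sq_sqrt n.cast_nonneg]
    cases ω j <;> cases η j <;> norm_num [bit]
  refine ⟨by fun_prop, ?_⟩
  rw [avg_sub, map_sum_mul_pi_gaussianReal, disagreement, hammingDist, ← Finset.sum_boole,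
    mul_div_assoc', Finset.mul_sum, Finset.sum_div]
  simp_rw [sq_term]

lemma layer_apply {n : ℕ} (ρ : ℝ) (z : LayerNoise n) (ω : Cube n) (i : Fin n) :
    layer ρ z ω i = signBit (√ρ * avg ω z.1 + √(1 - ρ) * avg ω (z.2 i)) := by
  have sqrt_pos : 0 < √(n : ℝ) := Real.sqrt_pos.2 (by exact_mod_cast i.pos)
  rw [← signBit_mul_of_pos sqrt_pos]
  simp only [layer, avg, weight, Finset.mul_sum, ← Finset.sum_add_distrib]
  congr 1
  exact Finset.sum_congr rfl fun j _ => by field_simp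

/-- The set of values of an individual noise that may overturn the sign of a common part of absolute
value at least `u`. -/
def deviation (ρ u : ℝ) : Set ℝ := {x | √ρ * u ≤ √(1 - ρ) * |x|}

lemma measurableSet_deviation (ρ u : ℝ) : MeasurableSet (deviation ρ u) :=
  measurableSet_le (by fun_prop) (by fun_prop)

lemma signBit_add_of_notMem_deviation {ρ u a b : ℝ} (hu : u ≤ |a|) (hb : b ∉ deviation ρ u) :
    signBit (√ρ * a + √(1 - ρ) * b) = signBit a := by
  have noise_lt : √(1 - ρ) * |b| < √ρ * |a| :=
    (not_le.1 hb).trans_le (by gcongr)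
  have sqrt_pos : 0 < √ρ :=
    pos_of_mul_pos_left ((by positivity : 0 ≤ √(1 - ρ) * |b|).trans_lt noise_lt) (abs_nonneg a)
  rw [← signBit_mul_of_pos sqrt_pos a]
  refine signBit_eq_of_abs_sub_lt ?_
  rwa [add_sub_cancel_left, abs_mul, abs_mul, abs_of_nonneg (Real.sqrt_nonneg _),
    abs_of_nonneg (Real.sqrt_nonneg _)]

lemma gaussianReal_deviation_le {ρ τ u : ℝ} (hρ : 0 ≤ ρ) (hτ : 0 < τ) (hρτ : 1 - ρ ≤ τ)
    (hu : 0 ≤ u) :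
    (gaussianReal 0 1).real (deviation ρ u) ≤ 2 * Real.exp (-(ρ * u ^ 2 / (2 * τ))) := by
  have subset : deviation ρ u ⊆ {x | √ρ * u / √τ ≤ |x|} := fun x hx => by
    rw [Set.mem_ofPred_eq, div_le_iff₀' (by positivity)]
    exact hx.trans (by gcongr)
  refine (measureReal_mono subset).trans ((gaussianReal_abs_ge_le 1 (by positivity)).trans_eq ?_)
  rw [div_pow, mul_pow, Real.sq_sqrt hρ, Real.sq_sqrt hτ.le, NNReal.coe_one]
  congr 2
  field

lemma disagreement_layer_le_card {n : ℕ} {ρ u w : ℝ} {z : LayerNoise n} {ω η : Cube n} (hu : 0 < u)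
    (common : u + w ≤ |avg ω z.1|) (close : |avg ω z.1 - avg η z.1| ≤ w)
    [∀ i, Decidable (avg ω (z.2 i) ∈ deviation ρ u ∨ avg η (z.2 i) ∈ deviation ρ u)] :
    disagreement (layer ρ z ω) (layer ρ z η) ≤
      (Finset.univ.filter fun i => avg ω (z.2 i) ∈ deviation ρ u ∨
        avg η (z.2 i) ∈ deviation ρ u).card / (n : ℝ) := by
  obtain ⟨le_avg_left, le_avg_right, common_sign⟩ :=
    le_abs_and_signBit_eq_of_abs_sub_le hu common close
  rw [disagreement, hammingDist]
  gcongr with i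
  contrapose!
  rintro ⟨left, right⟩
  rw [layer_apply, layer_apply, signBit_add_of_notMem_deviation le_avg_left left,
    signBit_add_of_notMem_deviation le_avg_right right, common_sign]

lemma measurePreserving_common (n : ℕ) :
    MeasurePreserving (Prod.fst : LayerNoise n → _) (layerLaw n)
      (Measure.pi fun _ => gaussianReal 0 1) :=
  measurePreserving_fst

lemma measurePreserving_individual {n : ℕ} (i : Fin n) :
    MeasurePreserving (fun z : LayerNoise n => z.2 i) (layerLaw n)
      (Measure.pi fun _ => gaussianReal 0 1) :=
  (measurePreserving_eval (fun _ : Fin n => Measure.pi fun _ : Fin n => gaussianReal 0 1) i).comp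
    measurePreserving_snd

lemma layerLaw_avg_individual {n : ℕ} (i : Fin n) (ω : Cube n) {s : Set ℝ} (hs : MeasurableSet s) :
    (layerLaw n).real {z | avg ω (z.2 i) ∈ s} = (gaussianReal 0 1).real s :=
  ((measurePreserving_avg i.pos.ne' ω).comp (measurePreserving_individual i)).measureReal_preimage
    hs.nullMeasurableSet

open Classical in
lemma layerLaw_le_card_deviation_le {n : ℕ} (ρ u : ℝ) (ω η : Cube n) {v : ℝ} (hv : 0 < v) :
    (layerLaw n).real {z | v ≤ (Finset.univ.filter fun i => avg ω (z.2 i) ∈ deviation ρ u ∨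
      avg η (z.2 i) ∈ deviation ρ u).card / (n : ℝ)} ≤
      2 * (gaussianReal 0 1).real (deviation ρ u) / v := by
  have hdev := measurableSet_deviation ρ u
  have measurable (i : Fin n) (ω : Cube n) :
      MeasurableSet {z : LayerNoise n | avg ω (z.2 i) ∈ deviation ρ u} :=
    (by fun_prop : Measurable fun z : LayerNoise n => avg ω (z.2 i)) hdev
  have either (i : Fin n) : (layerLaw n).real ({z | avg ω (z.2 i) ∈ deviation ρ u} ∪
      {z | avg η (z.2 i) ∈ deviation ρ u}) ≤ 2 * (gaussianReal 0 1).real (deviation ρ u) := by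
    refine (measureReal_union_le _ _).trans_eq ?_
    rw [layerLaw_avg_individual i ω hdev, layerLaw_avg_individual i η hdev, two_mul]
  have markov := measureReal_le_card_div_le (layerLaw n)
    (fun i => (measurable i ω).union (measurable i η)) (by positivity) either hv
  rwa [Fintype.card_fin] at markov

lemma layerLaw_abs_avg_lt_or_lt_abs_sub_le {n : ℕ} (hn : n ≠ 0) (ω η : Cube n) (v : ℝ) {w : ℝ}
    (hw : 0 < w) :
    (layerLaw n).real {z | |avg ω z.1| < v ∨ w < |avg ω z.1 - avg η z.1|} ≤
      (gaussianReal 0 1).real {x | |x| < v} + 4 * disagreement ω η / w ^ 2 := by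
  rw [Set.ofPred_or]
  refine (measureReal_union_le _ _).trans (add_le_add (Eq.le ?_) ?_)
  · exact ((measurePreserving_avg hn ω).comp (measurePreserving_common n)).measureReal_preimage
      (s := {x | |x| < v}) (measurableSet_lt (by fun_prop) (by fun_prop)).nullMeasurableSet
  · refine (((measurePreserving_avg_sub ω η).comp
      (measurePreserving_common n)).measureReal_preimage (s := {x | w < |x|})
      (measurableSet_lt (by fun_prop) (by fun_prop)).nullMeasurableSet).trans_le
      ((gaussianReal_abs_gt_le _ hw).trans_eq ?_)
    rw [Real.coe_toNNReal _ (mul_nonneg (by norm_num) (disagreement_nonneg ω η))]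

lemma layerLaw_le_disagreement_le {n : ℕ} (hn : n ≠ 0) (ρ : ℝ) (ω η : Cube n) {u w v : ℝ}
    (hu : 0 < u) (hw : 0 < w) (hv : 0 < v) :
    (layerLaw n).real {z | v ≤ disagreement (layer ρ z ω) (layer ρ z η)} ≤
      (gaussianReal 0 1).real {x | |x| < u + w} + 4 * disagreement ω η / w ^ 2 +
        2 * (gaussianReal 0 1).real (deviation ρ u) / v := by
  classical
  refine le_trans (measureReal_mono fun z hz => ?_) ((measureReal_union_le _ _).trans
    (add_le_add (layerLaw_abs_avg_lt_or_lt_abs_sub_le hn ω η (u + w) hw)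
      (layerLaw_le_card_deviation_le ρ u ω η hv)))
  by_cases exceptional : |avg ω z.1| < u + w ∨ w < |avg ω z.1 - avg η z.1|
  · exact .inl exceptional
  · rw [not_or, not_lt, not_lt] at exceptional
    exact .inr (hz.out.trans (disagreement_layer_le_card hu exceptional.1 exceptional.2))

/-! ### Coalescence of two orbits -/

section Coalescence

variable {n : ℕ} {ρ : ℝ} {ω η : Cube n}

instance (n : ℕ) : IsProbabilityMeasure (netLaw n) := by unfold netLaw; infer_instance

lemma measurable_layer (ρ : ℝ) (ω : Cube n) :
    Measurable fun z : LayerNoise n => layer ρ z ω := by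
  refine measurable_pi_lambda _ fun i => ?_
  simp_rw [layer_apply]
  exact measurable_signBit.comp (by fun_prop)

lemma measurable_layer_uncurry (ρ : ℝ) :
    Measurable fun q : Cube n × LayerNoise n => layer ρ q.2 q.1 :=
  measurable_from_prod_countable_right fun ω => measurable_layer ρ ω

lemma measurableSet_layer (ρ : ℝ) (ω η : Cube n) (P : Cube n → Cube n → Prop) :
    MeasurableSet {z | P (layer ρ z ω) (layer ρ z η)} :=
  ((measurable_layer ρ ω).prodMk (measurable_layer ρ η))
    (Set.toFinite {q : Cube n × Cube n | P q.1 q.2}).measurableSet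

lemma measurable_state (ρ : ℝ) (ω : Cube n) (t : ℕ) :
    Measurable fun Θ : ℕ → LayerNoise n => state ρ Θ ω t := by
  induction t with
  | zero => exact measurable_const
  | succ t ih => exact (measurable_layer_uncurry ρ).comp (ih.prodMk (measurable_pi_apply t))

lemma measurableSet_state (ρ : ℝ) (ω η : Cube n) (t : ℕ) (P : Cube n → Cube n → Prop) :
    MeasurableSet {Θ | P (state ρ Θ ω t) (state ρ Θ η t)} :=
  ((measurable_state ρ ω t).prodMk (measurable_state ρ η t))
    (Set.toFinite {q : Cube n × Cube n | P q.1 q.2}).measurableSet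

lemma state_succ_eq_state_layer (ρ : ℝ) (Θ : ℕ → LayerNoise n) (ω : Cube n) (t : ℕ) :
    state ρ Θ ω (t + 1) = state ρ (fun s => Θ (s + 1)) (layer ρ (Θ 0) ω) t := by
  induction t with
  | zero => rfl
  | succ t ih => rw [state, ih, state]

lemma state_eq_of_le {Θ : ℕ → LayerNoise n} {s t : ℕ} (hst : s ≤ t)
    (h : state ρ Θ ω s = state ρ Θ η s) : state ρ Θ ω t = state ρ Θ η t := by
  induction t, hst using Nat.le_induction with
  | base => exact h
  | succ t _ ih => rw [state, state, ih]

lemma netLaw_layer_mem_le {E : Cube n → Cube n → Set (ℕ → LayerNoise n)}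
    (hE : ∀ x y, MeasurableSet (E x y)) (A B : Cube n → Cube n → Prop) {c : ℝ} (hc : 0 ≤ c)
    (hEc : ∀ x y, B x y → ¬A x y → (netLaw n).real (E x y) ≤ c)
    (hE_zero : ∀ x y, ¬A x y → ¬B x y → (netLaw n).real (E x y) = 0) (ρ : ℝ) (ω η : Cube n) :
    (netLaw n).real {Θ | (fun t => Θ (t + 1)) ∈ E (layer ρ (Θ 0) ω) (layer ρ (Θ 0) η)} ≤
      (layerLaw n).real {z | A (layer ρ z ω) (layer ρ z η)} +
        c * (layerLaw n).real {z | B (layer ρ z ω) (layer ρ z η)} := by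
  have measurable : MeasurableSet {q : LayerNoise n × (ℕ → LayerNoise n) |
      q.2 ∈ E (layer ρ q.1 ω) (layer ρ q.1 η)} := by
    have decompose : {q : LayerNoise n × (ℕ → LayerNoise n) |
        q.2 ∈ E (layer ρ q.1 ω) (layer ρ q.1 η)} = ⋃ p : Cube n × Cube n,
          {z | layer ρ z ω = p.1 ∧ layer ρ z η = p.2} ×ˢ E p.1 p.2 := by
      ext q; simp
    rw [decompose]
    exact .iUnion fun p =>
      (measurableSet_layer ρ ω η fun x y => x = p.1 ∧ y = p.2).prod (hE _ _)
  refine ((measurePreserving_head_tail (layerLaw n)).measureReal_preimage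
    measurable.nullMeasurableSet).trans_le
      (measureReal_prod_le_add_mul _ _ measurable (measurableSet_layer ρ ω η A)
        (measurableSet_layer ρ ω η B) hc (fun z hz => hEc _ _ hz.1 hz.2) fun z hz => ?_)
  exact hE_zero _ _ (fun hA => hz (.inl hA)) fun hB => hz (.inr hB)

/-- The event that two orbits have not coalesced by time `k`, or that their proportion of
disagreements exceeds `v` at some time. -/
def escapeEvent (ρ v : ℝ) (k : ℕ) (ω η : Cube n) : Set (ℕ → LayerNoise n) :=
  {Θ | state ρ Θ ω k ≠ state ρ Θ η k ∨ ∃ t, v < disagreementProcess ρ ω η Θ t}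

lemma measurableSet_escapeEvent (ρ v : ℝ) (k : ℕ) (ω η : Cube n) :
    MeasurableSet (escapeEvent ρ v k ω η) := by
  rw [escapeEvent, Set.ofPred_or, Set.ofPred_exists]
  exact (measurableSet_state ρ ω η k (· ≠ ·)).union
    (.iUnion fun t => measurableSet_state ρ ω η t fun x y => v < disagreement x y)

lemma escapeEvent_self (ρ : ℝ) {v : ℝ} (hv : 0 ≤ v) (k : ℕ) (ω : Cube n) :
    escapeEvent ρ v k ω ω = ∅ := by
  simp [escapeEvent, disagreementProcess, disagreement_self, hv.not_gt]

lemma mem_escapeEvent_succ {v : ℝ} {k : ℕ} {Θ : ℕ → LayerNoise n} (hωη : disagreement ω η ≤ v)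
    (hΘ : Θ ∈ escapeEvent ρ v (k + 1) ω η) :
    (fun t => Θ (t + 1)) ∈ escapeEvent ρ v k (layer ρ (Θ 0) ω) (layer ρ (Θ 0) η) := by
  simp only [escapeEvent, disagreementProcess, Set.mem_ofPred_eq,
    ← state_succ_eq_state_layer] at hΘ ⊢
  refine hΘ.imp_right ?_
  rintro ⟨_ | t, ht⟩
  · exact absurd hωη (not_le.2 ht)
  · exact ⟨t, ht⟩

lemma netLaw_escapeEvent_le {v e q : ℝ} (hv : 0 ≤ v) (hq_le : q ≤ 1)
    (he : ∀ x y : Cube n, disagreement x y ≤ v →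
      (layerLaw n).real {z | v < disagreement (layer ρ z x) (layer ρ z y)} ≤ e)
    (hq : ∀ x y : Cube n, disagreement x y ≤ v →
      (layerLaw n).real {z | layer ρ z x ≠ layer ρ z y} ≤ q)
    (k : ℕ) (hωη : disagreement ω η ≤ v) :
    (netLaw n).real (escapeEvent ρ v k ω η) ≤ k * e + q ^ k := by
  have e_nonneg : 0 ≤ e := measureReal_nonneg.trans (he ω η hωη)
  have q_nonneg : 0 ≤ q := measureReal_nonneg.trans (hq ω η hωη)
  induction k generalizing ω η with
  | zero => simp
  | succ k ih =>
    calc (netLaw n).real (escapeEvent ρ v (k + 1) ω η)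
        ≤ (netLaw n).real {Θ | (fun t => Θ (t + 1)) ∈
            escapeEvent ρ v k (layer ρ (Θ 0) ω) (layer ρ (Θ 0) η)} :=
          measureReal_mono fun Θ => mem_escapeEvent_succ hωη
      _ ≤ (layerLaw n).real {z | v < disagreement (layer ρ z ω) (layer ρ z η)} +
            (k * e + q ^ k) * (layerLaw n).real {z | layer ρ z ω ≠ layer ρ z η} :=
          netLaw_layer_mem_le (measurableSet_escapeEvent ρ v k) (v < disagreement · ·) (· ≠ ·)
            (by positivity) (fun x y _ hxy => ih (not_lt.1 hxy))
            (fun x y _ hxy => by rw [not_not.1 hxy, escapeEvent_self ρ hv, measureReal_empty]) ρ ω η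
      _ ≤ e + (k * e + q ^ k) * q := by gcongr; exacts [he ω η hωη, hq ω η hωη]
      _ ≤ e + (k * e * 1 + q ^ k * q) := by rw [add_mul]; gcongr
      _ = (k + 1 : ℕ) * e + q ^ (k + 1) := by push_cast; ring

lemma netLaw_exists_lt_disagreementProcess_le {v e q b : ℝ} (hv : 0 ≤ v) (hq_le : q ≤ 1)
    (he : ∀ x y : Cube n, disagreement x y ≤ v →
      (layerLaw n).real {z | v < disagreement (layer ρ z x) (layer ρ z y)} ≤ e)
    (hq : ∀ x y : Cube n, disagreement x y ≤ v →
      (layerLaw n).real {z | layer ρ z x ≠ layer ρ z y} ≤ q)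
    (hb : (layerLaw n).real {z | v < disagreement (layer ρ z ω) (layer ρ z η)} ≤ b)
    {k T : ℕ} (hkT : k + 1 ≤ T) :
    (netLaw n).real {Θ | state ρ Θ ω T ≠ state ρ Θ η T ∨
      ∃ t, 1 ≤ t ∧ v < disagreementProcess ρ ω η Θ t} ≤ b + (k * e + q ^ k) := by
  have e_nonneg : 0 ≤ e :=
    measureReal_nonneg.trans (he ω ω (by rwa [disagreement_self]))
  have q_nonneg : 0 ≤ q :=
    measureReal_nonneg.trans (hq ω ω (by rwa [disagreement_self]))
  calc (netLaw n).real _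
      ≤ (netLaw n).real {Θ | (fun t => Θ (t + 1)) ∈
          escapeEvent ρ v k (layer ρ (Θ 0) ω) (layer ρ (Θ 0) η)} := by
        refine measureReal_mono fun Θ => ?_
        simp only [escapeEvent, disagreementProcess, Set.mem_ofPred_eq,
          ← state_succ_eq_state_layer]
        rintro (h | ⟨t, ht, h⟩)
        · exact .inl (mt (state_eq_of_le hkT) h)
        · exact .inr ⟨t - 1, by rwa [Nat.sub_add_cancel ht]⟩
    _ ≤ (layerLaw n).real {z | v < disagreement (layer ρ z ω) (layer ρ z η)} +
          (k * e + q ^ k) * (layerLaw n).real {_z | True} :=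
        netLaw_layer_mem_le (measurableSet_escapeEvent ρ v k) (v < disagreement · ·)
          (fun _ _ => True) (by positivity)
          (fun x y _ hxy => netLaw_escapeEvent_le hv hq_le he hq k (not_lt.1 hxy))
          (fun _ _ _ h => (h trivial).elim) ρ ω η
    _ ≤ b + (k * e + q ^ k) := by
        gcongr
        exact mul_le_of_le_one_right (by positivity) measureReal_le_one

lemma netLaw_state_and_state_succ_le {P Q : Cube n → Cube n → Prop} {c : ℝ} (hc : 0 ≤ c)
    (hPQ : ∀ x y, P x y → (layerLaw n).real {z | Q (layer ρ z x) (layer ρ z y)} ≤ c) (k : ℕ)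
    (ω η : Cube n) :
    (netLaw n).real {Θ | P (state ρ Θ ω k) (state ρ Θ η k) ∧
      Q (state ρ Θ ω (k + 1)) (state ρ Θ η (k + 1))} ≤ c := by
  induction k generalizing ω η with
  | zero =>
    by_cases hP : P ω η
    · exact (measureReal_mono fun Θ hΘ => hΘ.2).trans
        (((measurePreserving_eval_infinitePi (fun _ => layerLaw n) 0).measureReal_preimage
          (measurableSet_layer ρ ω η Q).nullMeasurableSet).trans_le (hPQ ω η hP))
    · simpa [state, hP] using hc
  | succ k ih =>
    have shifted := netLaw_layer_mem_le (E := fun x y => {Θ | P (state ρ Θ x k) (state ρ Θ y k) ∧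
      Q (state ρ Θ x (k + 1)) (state ρ Θ y (k + 1))})
      (fun x y => (measurableSet_state ρ x y k P).inter (measurableSet_state ρ x y (k + 1) Q))
      (fun _ _ => False) (fun _ _ => True) hc (fun x y _ _ => ih x y)
      (fun _ _ _ h => (h trivial).elim) ρ ω η
    simpa [← state_succ_eq_state_layer] using shifted

end Coalescence

/-! ### Nearly perfect correlation -/

/-- The scale `(log n) ^ (1 / 8)`, of which all rates below are powers: `log n` is its eighth power,
the depth `(log n) ^ (1 / 4)` is its square, and `log (log n)` is `8` times its logarithm. -/
noncomputable def scale (n : ℕ) : ℝ := Real.log n ^ (1 / 8 : ℝ)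

lemma scale_pow_eight (n : ℕ) : scale n ^ 8 = Real.log n := by
  rw [scale, ← Real.rpow_natCast, ← Real.rpow_mul (Real.log_natCast_nonneg n)]
  norm_num

lemma scale_sq (n : ℕ) : scale n ^ 2 = Real.log n ^ (1 / 4 : ℝ) := by
  rw [scale, ← Real.rpow_natCast, ← Real.rpow_mul (Real.log_natCast_nonneg n)]
  norm_num

lemma tendsto_scale : Tendsto scale atTop atTop :=
  (tendsto_rpow_atTop (by norm_num)).comp (Real.tendsto_log_atTop.comp tendsto_natCast_atTop_atTop)

/-- The assumption on the correlations of the network: `1 - ρ n` is smaller than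
`log (log n) / (18 * log n)` for all large `n`. -/
def NearlyPerfectCorrelation (ρ : ℕ → ℝ) : Prop :=
  ∀ᶠ n : ℕ in atTop, 1 - Real.log (Real.log n) / (18 * Real.log n) < ρ n

section Asymptotics

variable {ρ : ℕ → ℝ} {γ : ℝ}

lemma NearlyPerfectCorrelation.eventually_one_sub_le (hρ : NearlyPerfectCorrelation ρ) :
    ∀ᶠ n in atTop, 1 - ρ n ≤ 4 * Real.log (scale n) / (9 * scale n ^ 8) := by
  filter_upwards [hρ] with n hn
  have log_log : Real.log (Real.log n) = 8 * Real.log (scale n) := by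
    rw [← scale_pow_eight, Real.log_pow]; norm_num
  rw [log_log, ← scale_pow_eight] at hn
  refine (sub_lt_comm.1 hn).le.trans_eq ?_
  ring

lemma eventually_four_mul_log_div_le :
    ∀ᶠ x : ℝ in atTop, 4 * Real.log x / (9 * x ^ 8) ≤ 1 / 18 := by
  filter_upwards [eventually_ge_atTop 2] with x hx
  have log_le : Real.log x ≤ x := Real.log_le_self (by linarith)
  have pow_le : 2 ^ 7 * x ≤ x ^ 8 := by
    rw [pow_succ x 7]
    gcongr
  rw [div_le_iff₀ (by positivity)]
  linarith

lemma NearlyPerfectCorrelation.eventually_gaussianReal_deviation_le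
    (hρ : NearlyPerfectCorrelation ρ) :
    ∀ᶠ n in atTop, ∀ u, 0 ≤ u → (gaussianReal 0 1).real (deviation (ρ n) u) ≤
      2 * Real.exp (-(17 / 16 * (scale n ^ 8 * u ^ 2 / Real.log (scale n)))) := by
  filter_upwards [hρ.eventually_one_sub_le, tendsto_scale.eventually eventually_four_mul_log_div_le,
    tendsto_scale.eventually_gt_atTop 1] with n hn hsmall hscale u hu
  have log_pos := Real.log_pos hscale
  have ρ_ge : 17 / 18 ≤ ρ n := by linarith
  refine (gaussianReal_deviation_le (by linarith) (by positivity) hn hu).trans ?_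
  gcongr
  calc 17 / 16 * (scale n ^ 8 * u ^ 2 / Real.log (scale n))
      = 17 / 18 * u ^ 2 / (2 * (4 * Real.log (scale n) / (9 * scale n ^ 8))) := by field
    _ ≤ ρ n * u ^ 2 / (2 * (4 * Real.log (scale n) / (9 * scale n ^ 8))) := by gcongr

lemma NearlyPerfectCorrelation.eventually_gaussianReal_deviation_le_exp
    (hρ : NearlyPerfectCorrelation ρ) :
    ∀ᶠ n in atTop, ∀ u, 0 ≤ u → (gaussianReal 0 1).real (deviation (ρ n) u) ≤
      2 * Real.exp (-(scale n ^ 7 * u ^ 2)) := by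
  filter_upwards [hρ.eventually_gaussianReal_deviation_le, tendsto_scale.eventually_gt_atTop 1]
    with n hn hscale u hu
  have log_pos := Real.log_pos hscale
  have exponent_le :
      scale n ^ 7 * u ^ 2 ≤ 17 / 16 * (scale n ^ 8 * u ^ 2 / Real.log (scale n)) :=
    calc scale n ^ 7 * u ^ 2 = scale n ^ 8 * u ^ 2 / scale n := by field
      _ ≤ scale n ^ 8 * u ^ 2 / Real.log (scale n) := by
          gcongr
          exact Real.log_le_self (by linarith)
      _ ≤ 17 / 16 * (scale n ^ 8 * u ^ 2 / Real.log (scale n)) :=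
          le_mul_of_one_le_left (by positivity) (by norm_num)
  exact (hn u hu).trans
    (mul_le_mul_of_nonneg_left (Real.exp_le_exp.2 (neg_le_neg exponent_le)) zero_le_two)

lemma tendsto_pow_mul_exp_neg_mul (m : ℕ) {b : ℝ} (hb : 0 < b) :
    Tendsto (fun x : ℝ => x ^ m * Real.exp (-(x * b))) atTop (𝓝 0) := by
  simpa [mul_comm b] using tendsto_rpow_mul_exp_neg_mul_atTop_nhds_zero m b hb

lemma NearlyPerfectCorrelation.eventually_layerLaw_lt_disagreement_le
    (hρ : NearlyPerfectCorrelation ρ) :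
    ∀ᶠ n in atTop, ∀ (ω η : Cube n) (y : ℝ), 0 < y →
      (layerLaw n).real
          {z | (scale n ^ 10)⁻¹ < disagreement (layer (ρ n) z ω) (layer (ρ n) z η)} ≤
        2 * y + 4 * disagreement ω η / y ^ 2 +
          4 * (scale n ^ 10 * Real.exp (-(scale n ^ 7 * y ^ 2))) := by
  filter_upwards [hρ.eventually_gaussianReal_deviation_le_exp, eventually_ne_atTop 0,
    tendsto_scale.eventually_gt_atTop 0] with n hdev hn hscale ω η y hy
  calc (layerLaw n).real _
      ≤ (layerLaw n).real
          {z | (scale n ^ 10)⁻¹ ≤ disagreement (layer (ρ n) z ω) (layer (ρ n) z η)} :=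
        measureReal_mono fun z hz => hz.out.le
    _ ≤ (gaussianReal 0 1).real {x | |x| < y + y} + 4 * disagreement ω η / y ^ 2 +
          2 * (gaussianReal 0 1).real (deviation (ρ n) y) / (scale n ^ 10)⁻¹ :=
        layerLaw_le_disagreement_le hn _ ω η hy hy (by positivity)
    _ ≤ (y + y) + 4 * disagreement ω η / y ^ 2 +
          2 * (2 * Real.exp (-(scale n ^ 7 * y ^ 2))) / (scale n ^ 10)⁻¹ := by
        gcongr
        exacts [gaussianReal_abs_lt_le (by positivity), hdev y hy.le]
    _ = _ := by field

lemma NearlyPerfectCorrelation.exists_eventually_layerLaw_lt_disagreement_le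
    (hρ : NearlyPerfectCorrelation ρ) (hγ : 0 < γ) :
    ∃ r > 0, ∀ᶠ n in atTop, ∀ ω η : Cube n, disagreement ω η ≤ r →
      (layerLaw n).real
        {z | (scale n ^ 10)⁻¹ < disagreement (layer (ρ n) z ω) (layer (ρ n) z η)} ≤ γ := by
  obtain ⟨y, hy, rfl⟩ : ∃ y, 0 < y ∧ γ = 6 * y := ⟨γ / 6, by positivity, by ring⟩
  refine ⟨y ^ 3 / 2, by positivity, ?_⟩
  have decay : Tendsto (fun x : ℝ => 4 * (x ^ 10 * Real.exp (-(x * y ^ 2)))) atTop (𝓝 0) := by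
    simpa using (tendsto_pow_mul_exp_neg_mul 10 (by positivity : 0 < y ^ 2)).const_mul 4
  filter_upwards [hρ.eventually_layerLaw_lt_disagreement_le, tendsto_scale.eventually_ge_atTop 1,
    tendsto_scale.eventually (decay.eventually_le_const (by positivity : 0 < 2 * y))]
    with n hlayer hscale hdecay ω η hωη
  have scale_le : scale n ≤ scale n ^ 7 := le_self_pow₀ hscale (by norm_num)
  calc (layerLaw n).real _
      ≤ 2 * y + 4 * disagreement ω η / y ^ 2 +
          4 * (scale n ^ 10 * Real.exp (-(scale n ^ 7 * y ^ 2))) := hlayer ω η y hy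
    _ ≤ 2 * y + 4 * (y ^ 3 / 2) / y ^ 2 +
          4 * (scale n ^ 10 * Real.exp (-(scale n * y ^ 2))) := by gcongr
    _ ≤ 2 * y + 4 * (y ^ 3 / 2) / y ^ 2 + 2 * y := by gcongr
    _ = 6 * y := by field

lemma eventually_div_add_exp_le (hγ : 0 < γ) :
    ∀ᶠ x : ℝ in atTop, 2 * (x ^ 3)⁻¹ + 4 * (x ^ 10)⁻¹ / ((x ^ 3)⁻¹) ^ 2 +
      4 * (x ^ 10 * Real.exp (-(x ^ 7 * ((x ^ 3)⁻¹) ^ 2))) ≤ γ / x ^ 2 := by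
  have decay : Tendsto (fun x : ℝ => 2 * x⁻¹ + 4 * (x⁻¹) ^ 2 + 4 * (x ^ 12 * Real.exp (-x)))
      atTop (𝓝 0) := by
    simpa using ((tendsto_inv_atTop_zero.const_mul 2).add
      ((tendsto_inv_atTop_zero.pow 2).const_mul 4)).add
        ((Real.tendsto_pow_mul_exp_neg_atTop_nhds_zero 12).const_mul (4 : ℝ))
  filter_upwards [eventually_gt_atTop 0, decay.eventually_le_const hγ] with x hx hdecay
  have exponent : x ^ 7 * ((x ^ 3)⁻¹) ^ 2 = x := by field
  rw [exponent, le_div_iff₀ (by positivity)]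
  refine Eq.trans_le ?_ hdecay
  field

lemma NearlyPerfectCorrelation.eventually_layerLaw_lt_disagreement_le_div
    (hρ : NearlyPerfectCorrelation ρ) (hγ : 0 < γ) :
    ∀ᶠ n in atTop, ∀ ω η : Cube n, disagreement ω η ≤ (scale n ^ 10)⁻¹ →
      (layerLaw n).real
          {z | (scale n ^ 10)⁻¹ < disagreement (layer (ρ n) z ω) (layer (ρ n) z η)} ≤
        γ / scale n ^ 2 := by
  filter_upwards [hρ.eventually_layerLaw_lt_disagreement_le, tendsto_scale.eventually_gt_atTop 0,
    tendsto_scale.eventually (eventually_div_add_exp_le hγ)] with n hlayer hscale hle ω η hωη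
  refine (hlayer ω η (scale n ^ 3)⁻¹ (by positivity)).trans (le_trans ?_ hle)
  gcongr

lemma gaussianReal_abs_lt_sqrt_log_add_one_le {x : ℝ} (hx : 1 ≤ x) :
    (gaussianReal 0 1).real {y | |y| < √(Real.log x) + 1} ≤
      1 - (√(2 * Real.pi))⁻¹ * Real.exp (-4) / x := by
  set u := √(Real.log x)
  have u_sq : u ^ 2 = Real.log x := Real.sq_sqrt (Real.log_nonneg hx)
  have compl : {y : ℝ | |y| < u + 1} = {y | u + 1 ≤ |y|}ᶜ := by ext; simp
  have exponent : -4 - Real.log x ≤ -(u + 1 + 1) ^ 2 / 2 := by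
    nlinarith [sq_nonneg (u - 2)]
  rw [compl, probReal_compl_eq_one_sub (measurableSet_le (by fun_prop) (by fun_prop))]
  gcongr
  calc (√(2 * Real.pi))⁻¹ * Real.exp (-4) / x
      = (√(2 * Real.pi))⁻¹ * Real.exp (-4 - Real.log x) := by
        rw [Real.exp_sub, Real.exp_log (by positivity), mul_div_assoc]
    _ ≤ (√(2 * Real.pi))⁻¹ * Real.exp (-(u + 1 + 1) ^ 2 / 2) := by gcongr
    _ ≤ _ := le_gaussianReal_abs_ge (by positivity)

lemma eventually_inv_pow_add_exp_le {c : ℝ} (hc : 0 < c) :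
    ∀ᶠ x : ℝ in atTop, 4 * (x ^ 10)⁻¹ + 4 * Real.exp (-(x ^ 8 / 16)) ≤ c / x := by
  have decay : Tendsto (fun x : ℝ => 4 * (x⁻¹) ^ 9 + 4 * (x ^ 1 * Real.exp (-(x * 16⁻¹))))
      atTop (𝓝 0) := by
    simpa using ((tendsto_inv_atTop_zero.pow 9).const_mul (4 : ℝ)).add
      ((tendsto_pow_mul_exp_neg_mul 1 (by norm_num : (0 : ℝ) < 16⁻¹)).const_mul 4)
  filter_upwards [eventually_ge_atTop 1, decay.eventually_le_const hc] with x hx hdecay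
  have le_pow : x ≤ x ^ 8 := le_self_pow₀ hx (by norm_num)
  rw [le_div_iff₀ (by positivity)]
  calc (4 * (x ^ 10)⁻¹ + 4 * Real.exp (-(x ^ 8 / 16))) * x
      ≤ (4 * (x ^ 10)⁻¹ + 4 * Real.exp (-(x / 16))) * x := by gcongr
    _ = 4 * (x⁻¹) ^ 9 + 4 * (x ^ 1 * Real.exp (-(x * 16⁻¹))) := by
        rw [← div_eq_mul_inv x]; field
    _ ≤ c := hdecay

/-- This is where the constant `18` matters: it makes the exponent `17 / 16` exceed `1`, so that the
bound on a single deviation survives multiplication by `n = exp (scale n ^ 8)`. -/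
lemma NearlyPerfectCorrelation.eventually_natCast_mul_gaussianReal_deviation_le
    (hρ : NearlyPerfectCorrelation ρ) :
    ∀ᶠ n : ℕ in atTop, n * (gaussianReal 0 1).real (deviation (ρ n) √(Real.log (scale n))) ≤
      2 * Real.exp (-(scale n ^ 8 / 16)) := by
  filter_upwards [hρ.eventually_gaussianReal_deviation_le, eventually_gt_atTop 0,
    tendsto_scale.eventually_gt_atTop 1] with n hdev hn hscale
  have log_pos := Real.log_pos hscale
  have n_eq : (n : ℝ) = Real.exp (scale n ^ 8) := by
    rw [scale_pow_eight, Real.exp_log (by exact_mod_cast hn)]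
  calc n * (gaussianReal 0 1).real (deviation (ρ n) √(Real.log (scale n)))
      ≤ n * (2 * Real.exp (-(17 / 16 *
          (scale n ^ 8 * √(Real.log (scale n)) ^ 2 / Real.log (scale n))))) := by
        gcongr
        exact hdev _ (Real.sqrt_nonneg _)
    _ = n * (2 * Real.exp (-(17 / 16 * scale n ^ 8))) := by
        rw [Real.sq_sqrt log_pos.le, mul_div_cancel_right₀ _ log_pos.ne']
    _ = 2 * (Real.exp (scale n ^ 8) * Real.exp (-(17 / 16 * scale n ^ 8))) := by rw [n_eq]; ring
    _ = 2 * Real.exp (-(scale n ^ 8 / 16)) := by rw [← Real.exp_add]; ring_nf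

/-- The gain comes from the event that the common part exceeds `√(log (scale n)) + 1`: it has
probability at least of order `1 / scale n`, and on it typically no bit deviates. -/
lemma NearlyPerfectCorrelation.eventually_layerLaw_ne_le (hρ : NearlyPerfectCorrelation ρ) :
    ∃ c > 0, ∀ᶠ n in atTop, ∀ ω η : Cube n, disagreement ω η ≤ (scale n ^ 10)⁻¹ →
      (layerLaw n).real {z | layer (ρ n) z ω ≠ layer (ρ n) z η} ≤ 1 - c / scale n := by
  obtain ⟨c, hc, hc_eq⟩ : ∃ c, 0 < c ∧ (√(2 * Real.pi))⁻¹ * Real.exp (-4) = c + c :=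
    ⟨(√(2 * Real.pi))⁻¹ * Real.exp (-4) / 2, by positivity, by ring⟩
  refine ⟨c, hc, ?_⟩
  filter_upwards [hρ.eventually_natCast_mul_gaussianReal_deviation_le, eventually_ne_atTop 0,
    tendsto_scale.eventually_gt_atTop 1,
    tendsto_scale.eventually (eventually_inv_pow_add_exp_le hc)]
    with n hdev hn hscale hle ω η hωη
  have log_pos := Real.log_pos hscale
  calc (layerLaw n).real {z | layer (ρ n) z ω ≠ layer (ρ n) z η}
      ≤ (layerLaw n).real {z | 1 / (n : ℝ) ≤ disagreement (layer (ρ n) z ω) (layer (ρ n) z η)} :=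
        measureReal_mono fun z => one_div_le_disagreement
    _ ≤ (gaussianReal 0 1).real {x | |x| < √(Real.log (scale n)) + 1} +
          4 * disagreement ω η / 1 ^ 2 +
          2 * (gaussianReal 0 1).real (deviation (ρ n) √(Real.log (scale n))) / (1 / n) :=
        layerLaw_le_disagreement_le hn _ ω η (by positivity) one_pos (by positivity)
    _ = (gaussianReal 0 1).real {x | |x| < √(Real.log (scale n)) + 1} + 4 * disagreement ω η +
          2 * (n * (gaussianReal 0 1).real (deviation (ρ n) √(Real.log (scale n)))) := by
        rw [div_div_eq_mul_div, div_one]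
        ring
    _ ≤ (1 - (c + c) / scale n) + 4 * (scale n ^ 10)⁻¹ +
          2 * (2 * Real.exp (-(scale n ^ 8 / 16))) := by
        rw [← hc_eq]
        gcongr
        exact gaussianReal_abs_lt_sqrt_log_add_one_le hscale.le
    _ ≤ 1 - c / scale n := by rw [add_div]; linarith

lemma eventually_one_sub_div_pow_le {c : ℝ} (hc : 0 < c) (hγ : 0 < γ) :
    ∀ᶠ x : ℝ in atTop, ∀ k : ℕ, x ^ 2 ≤ k + 1 → (1 - c / x) ^ k ≤ γ := by
  have decay : Tendsto (fun x : ℝ => Real.exp (-(c * (x - 1)))) atTop (𝓝 0) :=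
    Real.tendsto_exp_neg_atTop_nhds_zero.comp
      ((tendsto_atTop_add_const_right _ (-1) tendsto_id).const_mul_atTop hc)
  filter_upwards [eventually_ge_atTop 1, eventually_ge_atTop c, decay.eventually_le_const hγ]
    with x hx hcx hdecay k hk
  calc (1 - c / x) ^ k ≤ Real.exp (-(c / x)) ^ k := by
        gcongr
        · exact sub_nonneg.2 (div_le_one_of_le₀ hcx (by positivity))
        · exact Real.one_sub_le_exp_neg _
    _ = Real.exp (-(c * (k / x))) := by rw [← Real.exp_nat_mul]; ring_nf
    _ ≤ Real.exp (-(c * (x - 1))) := by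
        gcongr
        rw [le_div_iff₀ (by positivity)]
        nlinarith
    _ ≤ γ := hdecay

lemma NearlyPerfectCorrelation.eventually_netLaw_le (hρ : NearlyPerfectCorrelation ρ)
    (hγ : 0 < γ) :
    ∃ r₀ > 0, ∀ r, 0 < r → r < r₀ → ∀ᶠ n : ℕ in atTop, ∀ ω η : Cube n, disagreement ω η < r →
      ∀ T : ℕ, Real.log n ^ (1 / 4 : ℝ) ≤ T →
        (netLaw n).real {Θ | state (ρ n) Θ ω T ≠ state (ρ n) Θ η T ∨
          ∃ t, 1 ≤ t ∧ r < disagreementProcess (ρ n) ω η Θ t} ≤ γ := by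
  obtain ⟨r₀, hr₀, hfirst⟩ := hρ.exists_eventually_layerLaw_lt_disagreement_le
    (by positivity : 0 < γ / 3)
  obtain ⟨c, hc, hcoalesce⟩ := hρ.eventually_layerLaw_ne_le
  refine ⟨r₀, hr₀, fun r hr hrr₀ => ?_⟩
  have threshold_le : ∀ᶠ x : ℝ in atTop, (x ^ 10)⁻¹ ≤ r :=
    (tendsto_pow_atTop (by norm_num)).inv_tendsto_atTop.eventually_le_const hr
  filter_upwards [hfirst, hcoalesce,
    hρ.eventually_layerLaw_lt_disagreement_le_div (by positivity : 0 < γ / 3),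
    tendsto_scale.eventually_gt_atTop 0, tendsto_scale.eventually threshold_le,
    tendsto_scale.eventually
      (eventually_one_sub_div_pow_le hc (by positivity : 0 < γ / 3))]
    with n hfirst hcoalesce hescape hscale hthreshold hsurvive ω η hωη T hT
  rw [← scale_sq] at hT
  obtain ⟨k, hk⟩ := Nat.exists_eq_succ_of_ne_zero (Nat.ceil_pos.2 (pow_pos hscale 2)).ne'
  have k_add_one_ge : scale n ^ 2 ≤ k + 1 := by exact_mod_cast hk ▸ Nat.le_ceil (scale n ^ 2)
  have k_le : (k : ℝ) ≤ scale n ^ 2 := by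
    have := Nat.ceil_lt_add_one (sq_nonneg (scale n))
    rw [hk] at this
    push_cast at this
    linarith
  calc (netLaw n).real _
      ≤ (netLaw n).real {Θ | state (ρ n) Θ ω T ≠ state (ρ n) Θ η T ∨
          ∃ t, 1 ≤ t ∧ (scale n ^ 10)⁻¹ < disagreementProcess (ρ n) ω η Θ t} :=
        measureReal_mono fun Θ => Or.imp_right fun ⟨t, ht, h⟩ => ⟨t, ht, hthreshold.trans_lt h⟩
    _ ≤ γ / 3 + (k * (γ / 3 / scale n ^ 2) + (1 - c / scale n) ^ k) :=
        netLaw_exists_lt_disagreementProcess_le (by positivity)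
          (sub_le_self _ (by positivity)) hescape hcoalesce (hfirst ω η (hωη.le.trans hrr₀.le))
          (hk.symm.trans_le (Nat.ceil_le.2 hT))
    _ ≤ γ / 3 + (scale n ^ 2 * (γ / 3 / scale n ^ 2) + γ / 3) := by
        gcongr
        exact hsurvive k k_add_one_ge
    _ = γ := by field

end Asymptotics

/-! ### Noise stability -/

section Noise

variable {n : ℕ}

instance (n : ℕ) (p : unitInterval) : IsProbabilityMeasure (bernoulliCube n p) := by
  unfold bernoulliCube; infer_instance

instance (n : ℕ) : IsProbabilityMeasure (uniformCube n) := by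
  unfold uniformCube; infer_instance

instance (n : ℕ) (ε : unitInterval) : IsProbabilityMeasure (noisePair n ε) :=
  Measure.isProbabilityMeasure_map (Measurable.of_discrete).aemeasurable

lemma bernoulliCube_real_apply_true (p : unitInterval) (i : Fin n) :
    (bernoulliCube n p).real {b | b i = true} = p :=
  ((measurePreserving_eval (fun _ : Fin n => bernoulliMeasure true false p) i).measureReal_preimage
    (measurableSet_singleton true).nullMeasurableSet).trans
    (bernoulliMeasure_real_apply_of_mem_of_notMem p (measurableSet_singleton true)
      (by simp) (by simp))

lemma disagreement_xor (ω b : Cube n) :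
    disagreement ω (fun i => xor (ω i) (b i)) =
      (Finset.univ.filter fun i => b i = true).card / (Fintype.card (Fin n) : ℝ) := by
  have ne_xor_iff (a c : Bool) : a ≠ xor a c ↔ c = true := by cases a <;> cases c <;> simp
  simp only [disagreement, hammingDist, Fintype.card_fin, ne_xor_iff]

lemma noisePair_le_disagreement_le (ε : unitInterval) {r : ℝ} (hr : 0 < r) :
    (noisePair n ε).real {q | r ≤ disagreement q.1 q.2} ≤ ε / r := by
  rw [noisePair, map_measureReal_apply .of_discrete (Set.toFinite _).measurableSet]
  simp only [Set.preimage_ofPred_eq, disagreement_xor]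
  have markov := measureReal_le_card_div_le (bernoulliCube n ε)
    (A := fun i => {b : Cube n | b i = true}) (fun i => (Set.toFinite _).measurableSet) ε.2.1
    (fun i => (bernoulliCube_real_apply_true ε i).le) hr
  exact (measurePreserving_snd.measureReal_preimage
    (Set.toFinite _).measurableSet.nullMeasurableSet).trans_le markov

lemma noisePair_ne_le (n : ℕ) (ε : unitInterval) :
    (noisePair n ε).real {q | q.1 ≠ q.2} ≤ n * ε := by
  rcases n.eq_zero_or_pos with rfl | hn
  · have none : {q : Cube 0 × Cube 0 | q.1 ≠ q.2} = ∅ :=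
      Set.eq_empty_of_forall_notMem fun q hq => hq (Subsingleton.elim _ _)
    simp [none]
  calc (noisePair n ε).real {q | q.1 ≠ q.2}
      ≤ (noisePair n ε).real {q | 1 / (n : ℝ) ≤ disagreement q.1 q.2} :=
        measureReal_mono fun q => one_div_le_disagreement
    _ ≤ ε / (1 / n) := noisePair_le_disagreement_le ε (by positivity)
    _ = n * ε := by field

lemma prod_noisePair_ne_le (π : Measure (BoolFn n)) [IsProbabilityMeasure π] (ε : unitInterval)
    (s : Set (Cube n × Cube n)) {c : ℝ} (hc : 0 ≤ c)
    (hπ : ∀ q ∉ s, π.real {f | f q.1 ≠ f q.2} ≤ c) :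
    (π.prod (noisePair n ε)).real {q | q.1 q.2.1 ≠ q.1 q.2.2} ≤ (noisePair n ε).real s + c := by
  rw [← Measure.prod_swap, map_measureReal_apply measurable_swap (Set.toFinite _).measurableSet]
  have slices := measureReal_prod_le_add_mul (noisePair n ε) π
    (s := Prod.swap ⁻¹' {q | q.1 q.2.1 ≠ q.1 q.2.2}) (Set.toFinite _).measurableSet
    (Set.toFinite s).measurableSet .univ hc (fun q hq => hπ q hq.2) (by simp)
  simpa using slices

lemma eventually_coe_unitInterval_le {c : ℝ} (hc : 0 < c) :
    ∀ᶠ ε : unitInterval in 𝓝[>] 0, (ε : ℝ) ≤ c :=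
  nhdsWithin_le_nhds ((continuous_subtype_val.tendsto (0 : unitInterval)).eventually_le_const hc)

lemma eventually_forall_prod_noisePair_ne_le {π : ∀ n, Measure (BoolFn n)}
    [∀ n, IsProbabilityMeasure (π n)]
    (hπ : ∀ γ : ℝ, 0 < γ → ∃ r > 0, ∀ᶠ n in atTop, ∀ ω η : Cube n,
      disagreement ω η < r → (π n).real {f | f ω ≠ f η} ≤ γ) {γ : ℝ} (hγ : 0 < γ) :
    ∀ᶠ ε : unitInterval in 𝓝[>] 0, ∀ n,
      ((π n).prod (noisePair n ε)).real {q | q.1 q.2.1 ≠ q.1 q.2.2} ≤ γ := by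
  obtain ⟨r, hr, hπr⟩ := hπ (γ / 2) (by positivity)
  obtain ⟨N, hN⟩ := eventually_atTop.1 hπr
  filter_upwards [eventually_coe_unitInterval_le (by positivity : 0 < γ / 2 * r),
    eventually_coe_unitInterval_le (by positivity : 0 < γ / 2 / (N + 1))] with ε hεr hεN n
  rcases le_or_gt N n with hNn | hnN
  · calc _ ≤ (noisePair n ε).real {q | r ≤ disagreement q.1 q.2} + γ / 2 :=
          prod_noisePair_ne_le (π n) ε _ (by positivity) fun q hq => hN n hNn _ _ (not_le.1 hq)
      _ ≤ ε / r + γ / 2 := by gcongr; exact noisePair_le_disagreement_le ε hr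
      _ ≤ γ / 2 + γ / 2 := by
          rw [← div_le_iff₀ hr] at hεr
          gcongr
      _ = γ := add_halves γ
  · calc _ ≤ (noisePair n ε).real {q | q.1 ≠ q.2} + 0 :=
          prod_noisePair_ne_le (π n) ε _ le_rfl fun q hq => by simp [not_not.1 hq]
      _ ≤ (N + 1) * (γ / 2 / (N + 1)) + γ / 2 := by
          have n_le : (n : ℝ) ≤ N + 1 := by exact_mod_cast hnN.le.trans N.le_succ
          gcongr ?_ + ?_
          · exact (noisePair_ne_le n ε).trans (mul_le_mul n_le hεN ε.2.1 (by positivity))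
          · positivity
      _ = γ := by field

lemma annealedNoiseStable_of_forall {π : ∀ n, Measure (BoolFn n)}
    [∀ n, IsProbabilityMeasure (π n)]
    (hπ : ∀ γ : ℝ, 0 < γ → ∃ r > 0, ∀ᶠ n in atTop, ∀ ω η : Cube n,
      disagreement ω η < r → (π n).real {f | f ω ≠ f η} ≤ γ) :
    AnnealedNoiseStable π := by
  refine ENNReal.tendsto_nhds_zero.2 fun δ hδ => ?_
  obtain ⟨γ, -, hγ, hγδ⟩ := ENNReal.lt_iff_exists_real_btwn.1 hδ
  filter_upwards [eventually_forall_prod_noisePair_ne_le hπ (ENNReal.ofReal_pos.1 hγ)] with ε hε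
  refine iSup_le fun n => le_trans ?_ hγδ.le
  rw [← ofReal_measureReal]
  exact ENNReal.ofReal_le_ofReal (hε n)

lemma AnnealedNoiseStable.quenchedNoiseStable {π : ∀ n, Measure (BoolFn n)}
    [∀ n, IsProbabilityMeasure (π n)] (hπ : AnnealedNoiseStable π) : QuenchedNoiseStable π := by
  intro δ hδ
  have : (𝓝[>] (0 : unitInterval)).NeBot := nhdsGT_neBot_of_exists_gt ⟨1, zero_lt_one⟩
  obtain ⟨ε, hsup, hε⟩ := ((ENNReal.tendsto_nhds_zero.1 hπ (ENNReal.ofReal (δ * δ))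
    (by simpa using by positivity)).and self_mem_nhdsWithin).exists
  refine ⟨ε, hε, fun n => ?_⟩
  have mean_le : ∫⁻ f, noisePair n ε {q | f q.1 ≠ f q.2} ∂π n ≤ ENNReal.ofReal (δ * δ) := by
    refine le_trans (Measure.prod_apply (Set.toFinite _).measurableSet).ge ((le_iSup
      (fun n => ((π n).prod (noisePair n ε)) {q | q.1 q.2.1 ≠ q.1 q.2.2}) n).trans hsup)
  have markov : π n {f | ENNReal.ofReal δ ≤ noisePair n ε {q | f q.1 ≠ f q.2}} ≤
      ENNReal.ofReal δ :=
    (meas_ge_le_lintegral_div Measurable.of_discrete.aemeasurable (by simpa using hδ)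
      ENNReal.ofReal_ne_top).trans
      (ENNReal.div_le_of_le_mul (mean_le.trans_eq (ENNReal.ofReal_mul hδ.le)))
  have compl : {f : BoolFn n | noisePair n ε {q | f q.1 ≠ f q.2} < ENNReal.ofReal δ} =
      {f | ENNReal.ofReal δ ≤ noisePair n ε {q | f q.1 ≠ f q.2}}ᶜ := by
    ext f; simp
  rw [compl, prob_compl_eq_one_sub (Set.toFinite _).measurableSet]
  gcongr

lemma measurable_boolFn_state (ρ : ℝ) (T : ℕ) (h : BoolFn n) :
    Measurable fun (Θ : ℕ → LayerNoise n) (ω : Cube n) => h (state ρ Θ ω T) :=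
  measurable_pi_lambda _ fun ω => (Measurable.of_discrete (f := h)).comp (measurable_state ρ ω T)

instance (n : ℕ) (ρ : ℝ) (T : ℕ) (h : BoolFn n) : IsProbabilityMeasure (functionLaw n ρ T h) :=
  Measure.isProbabilityMeasure_map (measurable_boolFn_state ρ T h).aemeasurable

lemma functionLaw_ne_eq (ρ : ℝ) (T : ℕ) (h : BoolFn n) (ω η : Cube n) :
    (functionLaw n ρ T h).real {f | f ω ≠ f η} =
      (netLaw n).real {Θ | h (state ρ Θ ω T) ≠ h (state ρ Θ η T)} :=
  map_measureReal_apply (measurable_boolFn_state ρ T h) (Set.toFinite _).measurableSet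

end Noise

/-! ### Sharp thresholds -/

section Threshold

variable {n : ℕ} {ρ : ℝ}

lemma SharpThreshold.eventually_le {h : ∀ n, BoolFn n} (hh : SharpThreshold h) {c γ : ℝ}
    (hc : 0 < c) (hγ : 0 < γ) :
    ∀ᶠ n in atTop, ∀ p : unitInterval, c ≤ |(p : ℝ) - 1 / 2| →
      (bernoulliCube n p).real {ω | h n ω ≠ signBit ((p : ℝ) - 1 / 2)} ≤ γ := by
  suffices uniform : ∀ᶠ n in atTop, ∀ p : {p : unitInterval // c ≤ |(p : ℝ) - 1 / 2|},
      (bernoulliCube n p).real {ω | h n ω ≠ signBit ((p : ℝ) - 1 / 2)} ≤ γ from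
    uniform.mono fun n hn p hp => hn ⟨p, hp⟩
  cases isEmpty_or_nonempty {p : unitInterval // c ≤ |(p : ℝ) - 1 / 2|}
  · exact .of_forall fun n => isEmptyElim
  refine eventually_forall_of_forall_seq fun p => ?_
  have tendsto_real := (ENNReal.tendsto_toReal ENNReal.one_ne_top).comp
    (hh (fun n => p n) ⟨c, hc, fun n => (p n).2⟩)
  filter_upwards [tendsto_real.eventually_const_le (sub_lt_self _ hγ :
    (1 : ENNReal).toReal - γ < (1 : ENNReal).toReal)] with n hn
  have compl := probReal_compl_eq_one_sub (μ := bernoulliCube n (p n))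
    (Set.toFinite {ω | h n ω = signBit (((p n : unitInterval) : ℝ) - 1 / 2)}).measurableSet
  rw [ENNReal.toReal_one, sub_le_comm] at hn
  exact compl.trans_le hn

lemma eq_bernoulliMeasure (μ : Measure Bool) [IsProbabilityMeasure μ] :
    μ = bernoulliMeasure true false ⟨μ.real {true}, measureReal_nonneg, measureReal_le_one⟩ := by
  have apply_false (ν : Measure Bool) [IsProbabilityMeasure ν] : ν {false} = 1 - ν {true} := by
    rw [← prob_compl_eq_one_sub (measurableSet_singleton true)]
    congr 1
    ext b
    cases b <;> simp
  set p : unitInterval := ⟨μ.real {true}, measureReal_nonneg, measureReal_le_one⟩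
  have apply_true : μ {true} = bernoulliMeasure true false p {true} := by
    rw [← ofReal_measureReal, ← ofReal_measureReal,
      bernoulliMeasure_real_apply_of_mem_of_notMem p (measurableSet_singleton true)
        (Set.mem_singleton true) (by simp)]
  refine Measure.ext_of_singleton fun b => ?_
  cases b
  · rw [apply_false μ, apply_false, apply_true]
  · exact apply_true

lemma measurableSet_signBit_eq (ρ a : ℝ) (b : Bool) :
    MeasurableSet {x | signBit (√ρ * a + √(1 - ρ) * x) = b} :=
  (measurable_signBit.comp (by fun_prop : Measurable fun x => √ρ * a + √(1 - ρ) * x))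
    (measurableSet_singleton b)

/-- The conditional probability that a bit of the next layer is `+1`, given that the normalised
scalar product of the common Gaussians with the current state is `a`. -/
noncomputable def bitProb (ρ a : ℝ) : unitInterval :=
  ⟨(gaussianReal 0 1).real {x | signBit (√ρ * a + √(1 - ρ) * x) = true},
    measureReal_nonneg, measureReal_le_one⟩

lemma map_layer_eq_bernoulliCube (hn : n ≠ 0) (ρ : ℝ) (x : Fin n → ℝ) (ω : Cube n) :
    (Measure.pi fun _ => Measure.pi fun _ => gaussianReal 0 1).map
      (fun ψ : Fin n → Fin n → ℝ => layer ρ (x, ψ) ω) = bernoulliCube n (bitProb ρ (avg ω x)) := by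
  have layer_eq : (fun ψ : Fin n → Fin n → ℝ => layer ρ (x, ψ) ω) =
      fun ψ i => signBit (√ρ * avg ω x + √(1 - ρ) * avg ω (ψ i)) := by
    ext ψ i
    rw [layer_apply]
  have measurable : Measurable fun y => signBit (√ρ * avg ω x + √(1 - ρ) * avg ω y) :=
    measurable_signBit.comp (by fun_prop)
  have := Measure.isProbabilityMeasure_map (μ := Measure.pi fun _ : Fin n => gaussianReal 0 1)
    measurable.aemeasurable
  have bit_law : (Measure.pi fun _ : Fin n => gaussianReal 0 1).map
      (fun y => signBit (√ρ * avg ω x + √(1 - ρ) * avg ω y)) =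
      bernoulliMeasure true false (bitProb ρ (avg ω x)) := by
    rw [eq_bernoulliMeasure (Measure.map _ _)]
    congr 1
    refine Subtype.ext ((map_measureReal_apply measurable (measurableSet_singleton _)).trans ?_)
    exact (measurePreserving_avg hn ω).measureReal_preimage
      (measurableSet_signBit_eq ρ (avg ω x) true).nullMeasurableSet
  rw [layer_eq, Measure.pi_map_pi fun _ => measurable.aemeasurable, bit_law, bernoulliCube]

lemma bitProb_of_deviation_le {a u : ℝ} (ha : u ≤ |a|)
    (hdev : (gaussianReal 0 1).real (deviation ρ u) ≤ 1 / 4) :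
    1 / 4 ≤ |(bitProb ρ a : ℝ) - 1 / 2| ∧ signBit ((bitProb ρ a : ℝ) - 1 / 2) = signBit a := by
  have atypical (b : Bool) (hb : b ≠ signBit a) :
      (gaussianReal 0 1).real {x | signBit (√ρ * a + √(1 - ρ) * x) = b} ≤ 1 / 4 := by
    refine (measureReal_mono fun x hx => ?_).trans hdev
    by_contra hx_dev
    exact hb (hx.symm.trans (signBit_add_of_notMem_deviation ha hx_dev))
  have compl : 1 - (bitProb ρ a : ℝ) =
      (gaussianReal 0 1).real {x | signBit (√ρ * a + √(1 - ρ) * x) = false} := by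
    rw [bitProb, ← probReal_compl_eq_one_sub (measurableSet_signBit_eq ρ a true)]
    congr 1
    ext x
    simp
  cases ha_sign : signBit a
  · have le_quarter : (bitProb ρ a : ℝ) ≤ 1 / 4 := atypical true (by simp [ha_sign])
    rw [signBit, decide_eq_false_iff_not, abs_of_nonpos (by linarith)]
    constructor <;> linarith
  · have ge_quarter := atypical false (by simp [ha_sign])
    rw [← compl] at ge_quarter
    rw [signBit, decide_eq_true_iff, abs_of_nonneg (by linarith)]
    constructor <;> linarith

lemma layerLaw_boolFn_ne_signBit_le (hn : n ≠ 0) {u c : ℝ} (hc : 0 ≤ c) {h : BoolFn n}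
    (hh : ∀ p : unitInterval, 1 / 4 ≤ |(p : ℝ) - 1 / 2| →
      (bernoulliCube n p).real {ω | h ω ≠ signBit ((p : ℝ) - 1 / 2)} ≤ c)
    (hdev : (gaussianReal 0 1).real (deviation ρ u) ≤ 1 / 4) (ω : Cube n) :
    (layerLaw n).real {z | u ≤ |avg ω z.1| ∧ h (layer ρ z ω) ≠ signBit (avg ω z.1)} ≤ c := by
  have measurable : MeasurableSet {z : LayerNoise n | u ≤ |avg ω z.1| ∧
      h (layer ρ z ω) ≠ signBit (avg ω z.1)} := by
    have large : MeasurableSet {z : LayerNoise n | u ≤ |avg ω z.1|} :=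
      measurableSet_le (by fun_prop) (by fun_prop)
    refine large.inter (measurableSet_eq_fun ?_ ?_).compl
    · exact (Measurable.of_discrete (f := h)).comp (measurable_layer ρ ω)
    · exact measurable_signBit.comp (by fun_prop)
  rw [layerLaw]
  refine (measureReal_prod_le_add_mul _ _ measurable .empty .univ hc (fun x _ => ?_)
    (by simp)).trans_eq (by simp)
  by_cases hx : u ≤ |avg ω x|
  · obtain ⟨far, sign⟩ := bitProb_of_deviation_le hx hdev
    have slice_measurable : Measurable fun ψ : Fin n → Fin n → ℝ => layer ρ (x, ψ) ω :=
      (measurable_layer ρ ω).comp measurable_prodMk_left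
    have slice := hh _ far
    rw [← map_layer_eq_bernoulliCube hn,
      map_measureReal_apply slice_measurable (Set.toFinite _).measurableSet, sign] at slice
    simpa [hx] using slice
  · simpa [hx] using hc

lemma layerLaw_boolFn_ne_le (hn : n ≠ 0) {u w c : ℝ} (hc : 0 ≤ c) (hu : 0 < u) (hw : 0 < w)
    {h : BoolFn n}
    (hh : ∀ p : unitInterval, 1 / 4 ≤ |(p : ℝ) - 1 / 2| →
      (bernoulliCube n p).real {ω | h ω ≠ signBit ((p : ℝ) - 1 / 2)} ≤ c)
    (hdev : (gaussianReal 0 1).real (deviation ρ u) ≤ 1 / 4) (ω η : Cube n) :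
    (layerLaw n).real {z | h (layer ρ z ω) ≠ h (layer ρ z η)} ≤
      (u + w) + 4 * disagreement ω η / w ^ 2 + (c + c) := by
  have reads_sign := layerLaw_boolFn_ne_signBit_le hn hc hh hdev
  have common := (layerLaw_abs_avg_lt_or_lt_abs_sub_le hn ω η (u + w) hw).trans
    (add_le_add_left (gaussianReal_abs_lt_le (by positivity)) _)
  refine le_trans (measureReal_mono fun z hz => ?_) ((measureReal_union_le _ _).trans
    (add_le_add common
      ((measureReal_union_le _ _).trans (add_le_add (reads_sign ω) (reads_sign η)))))
  by_cases exceptional : |avg ω z.1| < u + w ∨ w < |avg ω z.1 - avg η z.1|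
  · exact .inl exceptional
  rw [not_or, not_lt, not_lt] at exceptional
  obtain ⟨left, right, sign⟩ :=
    le_abs_and_signBit_eq_of_abs_sub_le hu exceptional.1 exceptional.2
  by_cases reads_left : h (layer ρ z ω) = signBit (avg ω z.1)
  · exact .inr (.inr ⟨right, fun reads_right => hz (by rw [reads_left, reads_right, sign])⟩)
  · exact .inr (.inl ⟨left, reads_left⟩)

end Threshold

section ThresholdNetwork

variable {ρ : ℕ → ℝ} {γ : ℝ}

lemma NearlyPerfectCorrelation.eventually_gaussianReal_deviation_le_const
    (hρ : NearlyPerfectCorrelation ρ) {u : ℝ} (hu : 0 < u) (hγ : 0 < γ) :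
    ∀ᶠ n in atTop, (gaussianReal 0 1).real (deviation (ρ n) u) ≤ γ := by
  have decay : Tendsto (fun x : ℝ => 2 * Real.exp (-(x ^ 7 * u ^ 2))) atTop (𝓝 0) := by
    simpa using ((Real.tendsto_exp_neg_atTop_nhds_zero.comp
      ((tendsto_pow_atTop (by norm_num : 7 ≠ 0)).atTop_mul_const
        (by positivity : 0 < u ^ 2))).const_mul 2)
  filter_upwards [hρ.eventually_gaussianReal_deviation_le_exp,
    tendsto_scale.eventually (decay.eventually_le_const hγ)] with n hdev hdecay
  exact (hdev u hu.le).trans hdecay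

lemma SharpThreshold.exists_eventually_layerLaw_ne_le {h : ∀ n, BoolFn n} (hh : SharpThreshold h)
    (hρ : NearlyPerfectCorrelation ρ) (hγ : 0 < γ) :
    ∃ r > 0, ∀ᶠ n in atTop, ∀ ω η : Cube n, disagreement ω η ≤ r →
      (layerLaw n).real {z | h n (layer (ρ n) z ω) ≠ h n (layer (ρ n) z η)} ≤ γ := by
  obtain ⟨y, hy, rfl⟩ : ∃ y, 0 < y ∧ γ = 8 * y := ⟨γ / 8, by positivity, by ring⟩
  refine ⟨y ^ 3, by positivity, ?_⟩
  filter_upwards [hh.eventually_le (by norm_num : (0 : ℝ) < 1 / 4) hy,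
    hρ.eventually_gaussianReal_deviation_le_const hy (by norm_num : (0 : ℝ) < 1 / 4),
    eventually_ne_atTop 0] with n hthreshold hdev hn ω η hωη
  calc (layerLaw n).real _
      ≤ (y + y) + 4 * disagreement ω η / y ^ 2 + (y + y) :=
        layerLaw_boolFn_ne_le hn hy.le hy hy hthreshold hdev ω η
    _ ≤ (y + y) + 4 * y ^ 3 / y ^ 2 + (y + y) := by gcongr
    _ = 8 * y := by field

lemma SharpThreshold.exists_eventually_netLaw_ne_le {h : ∀ n, BoolFn n} (hh : SharpThreshold h)
    (hρ : NearlyPerfectCorrelation ρ) (hγ : 0 < γ) :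
    ∃ r > 0, ∀ᶠ n : ℕ in atTop, ∀ ω η : Cube n, disagreement ω η < r → ∀ T : ℕ, 1 ≤ T →
      (netLaw n).real {Θ | h n (state (ρ n) Θ ω T) ≠ h n (state (ρ n) Θ η T)} ≤ γ := by
  obtain ⟨r₁, hr₁, hlast⟩ := hh.exists_eventually_layerLaw_ne_le hρ (half_pos hγ)
  obtain ⟨r₀, hr₀, hnet⟩ := hρ.eventually_netLaw_le (half_pos hγ)
  obtain ⟨r, hr, hr_lt⟩ := exists_between (lt_min hr₀ hr₁)
  obtain ⟨hrr₀, hrr₁⟩ := lt_min_iff.1 hr_lt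
  refine ⟨r, hr, ?_⟩
  filter_upwards [hlast, hnet r hr hrr₀] with n hlast hnet ω η hωη T hT
  obtain ⟨k, rfl⟩ := Nat.exists_eq_add_of_le' hT
  have last_layer := netLaw_state_and_state_succ_le (P := fun x y => disagreement x y ≤ r)
    (Q := fun x y => h n x ≠ h n y) (half_pos hγ).le
    (fun x y hxy => hlast x y (hxy.trans hrr₁.le)) k ω η
  have before := hnet ω η hωη _ (Nat.le_ceil (Real.log n ^ (1 / 4 : ℝ)))
  refine (measureReal_mono fun Θ hΘ => ?_).trans ((measureReal_union_le _ _).trans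
    ((add_le_add last_layer before).trans_eq (add_halves γ)))
  by_cases close : disagreementProcess (ρ n) ω η Θ k ≤ r
  · exact .inl ⟨close, hΘ⟩
  · refine .inr (.inr ⟨k, Nat.one_le_iff_ne_zero.2 ?_, not_le.1 close⟩)
    rintro rfl
    exact close hωη.le

end ThresholdNetwork

/-! ### The limit of large width -/

section Limits

variable {ρ : ℕ → ℝ}

lemma limsup_measure_lt_ofReal {Ω : ℕ → Type*} [∀ n, MeasurableSpace (Ω n)]
    {μ : ∀ n, Measure (Ω n)} [∀ n, IsFiniteMeasure (μ n)] {A B : ∀ n, Set (Ω n)} {c δ : ℝ}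
    (hAB : ∀ n, A n ⊆ B n) (hB : ∀ᶠ n in atTop, (μ n).real (B n) ≤ c) (hc : c < δ) :
    limsup (fun n => μ n (A n)) atTop < ENNReal.ofReal δ := by
  obtain ⟨N, hN⟩ := hB.exists
  have hδ : 0 < δ := (measureReal_nonneg.trans hN).trans_lt hc
  refine (limsup_le_of_le (by isBoundedDefault) ?_).trans_lt
    ((ENNReal.ofReal_lt_ofReal_iff hδ).2 hc)
  filter_upwards [hB] with n hn
  calc μ n (A n) ≤ μ n (B n) := measure_mono (hAB n)
    _ = ENNReal.ofReal ((μ n).real (B n)) := by rw [ofReal_measureReal]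
    _ ≤ ENNReal.ofReal c := ENNReal.ofReal_le_ofReal hn

lemma state_ne_of_disagreementProcess_pos {n : ℕ} {ρ : ℝ} {ω η : Cube n} {Θ : ℕ → LayerNoise n}
    {t : ℕ} (h : 0 < disagreementProcess ρ ω η Θ t) : state ρ Θ ω t ≠ state ρ Θ η t := by
  intro heq
  rw [disagreementProcess, heq, disagreement_self] at h
  exact lt_irrefl _ h

lemma NearlyPerfectCorrelation.exists_limsup_netLaw_lt (hρ : NearlyPerfectCorrelation ρ)
    {T : ℕ → ℕ} (hT : ∀ᶠ n : ℕ in atTop, Real.log n ^ (1 / 4 : ℝ) ≤ T n) {δ : ℝ} (hδ : 0 < δ) :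
    ∃ r₀ > 0, ∀ r, 0 < r → r < r₀ → ∀ ω η : ∀ n, Cube n,
      (∀ᶠ n in atTop, disagreement (ω n) (η n) < r) →
      limsup (fun n => netLaw n ({Θ | 0 < disagreementProcess (ρ n) (ω n) (η n) Θ (T n)} ∪
        {Θ | ∃ t ∈ Finset.Icc 1 (T n), r < disagreementProcess (ρ n) (ω n) (η n) Θ t})) atTop
          < ENNReal.ofReal δ ∧
      limsup (fun n => netLaw n
        {Θ | ∃ t, 1 ≤ t ∧ r < disagreementProcess (ρ n) (ω n) (η n) Θ t}) atTop
          < ENNReal.ofReal δ := by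
  obtain ⟨r₀, hr₀, hnet⟩ := hρ.eventually_netLaw_le (half_pos hδ)
  refine ⟨r₀, hr₀, fun r hr hrr₀ ω η hωη => ?_⟩
  have bound : ∀ᶠ n in atTop, (netLaw n).real {Θ |
      state (ρ n) Θ (ω n) (T n) ≠ state (ρ n) Θ (η n) (T n) ∨
        ∃ t, 1 ≤ t ∧ r < disagreementProcess (ρ n) (ω n) (η n) Θ t} ≤ δ / 2 := by
    filter_upwards [hnet r hr hrr₀, hωη, hT] with n hn hclose hdeep
    exact hn _ _ hclose _ hdeep
  refine ⟨limsup_measure_lt_ofReal (fun n => ?_) bound (half_lt_self hδ),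
    limsup_measure_lt_ofReal (fun n Θ => .inr) bound (half_lt_self hδ)⟩
  rintro Θ (distinct | ⟨t, ht, escape⟩)
  · exact .inl (state_ne_of_disagreementProcess_pos distinct)
  · exact .inr ⟨t, (Finset.mem_Icc.1 ht).1, escape⟩

lemma NearlyPerfectCorrelation.annealedNoiseStable_of_sharpThreshold
    (hρ : NearlyPerfectCorrelation ρ) {h : ∀ n, BoolFn n} (hh : SharpThreshold h)
    {T : ℕ → ℕ} (hT : ∀ n, 1 ≤ T n) :
    AnnealedNoiseStable fun n => functionLaw n (ρ n) (T n) (h n) := by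
  refine annealedNoiseStable_of_forall fun γ hγ => ?_
  obtain ⟨r, hr, hnet⟩ := hh.exists_eventually_netLaw_ne_le hρ hγ
  refine ⟨r, hr, ?_⟩
  filter_upwards [hnet] with n hn ω η hωη
  rw [functionLaw_ne_eq]
  exact hn ω η hωη (T n) (hT n)

lemma NearlyPerfectCorrelation.annealedNoiseStable_of_log_rpow_le
    (hρ : NearlyPerfectCorrelation ρ) (h : ∀ n, BoolFn n) {T : ℕ → ℕ}
    (hT : ∀ᶠ n : ℕ in atTop, Real.log n ^ (1 / 4 : ℝ) ≤ T n) :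
    AnnealedNoiseStable fun n => functionLaw n (ρ n) (T n) (h n) := by
  refine annealedNoiseStable_of_forall fun γ hγ => ?_
  obtain ⟨r₀, hr₀, hnet⟩ := hρ.eventually_netLaw_le hγ
  refine ⟨r₀ / 2, half_pos hr₀, ?_⟩
  filter_upwards [hnet _ (half_pos hr₀) (half_lt_self hr₀), hT] with n hn hdeep ω η hωη
  rw [functionLaw_ne_eq]
  refine (measureReal_mono fun Θ hΘ => ?_).trans (hn ω η hωη (T n) hdeep)
  exact .inl fun heq => hΘ (congrArg _ heq)

end Limits

end NoisyNet

theorem mainTheorem6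
    (ρ : ℕ → ℝ) (hρ : ∀ n, 0 < ρ n ∧ ρ n ≤ 1)
    (hρ_large : ∀ᶠ n : ℕ in atTop,
      1 - Real.log (Real.log n) / (18 * Real.log n) < ρ n) :
    (∀ T : ℕ → ℕ, (∀ᶠ n : ℕ in atTop, (Real.log n) ^ (1 / 4 : ℝ) ≤ (T n : ℝ)) →
      ∀ δ : ℝ, 0 < δ → ∃ ε₀ : ℝ, 0 < ε₀ ∧ ∀ ε : ℝ, 0 < ε → ε < ε₀ →
        ∀ ω η : ∀ n, NoisyNet.Cube n,
          (∀ᶠ n in atTop, NoisyNet.disagreement (ω n) (η n) < ε ^ 2 / 2) →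
          limsup (fun n => NoisyNet.netLaw n
            ({Θ | 0 < NoisyNet.disagreementProcess (ρ n) (ω n) (η n) Θ (T n)} ∪
              {Θ | ∃ t ∈ Finset.Icc 1 (T n),
                ε ^ 2 / 2 < NoisyNet.disagreementProcess (ρ n) (ω n) (η n) Θ t})) atTop
              < ENNReal.ofReal δ ∧
          limsup (fun n => NoisyNet.netLaw n
            {Θ | ∃ t : ℕ, 1 ≤ t ∧
              ε ^ 2 / 2 < NoisyNet.disagreementProcess (ρ n) (ω n) (η n) Θ t}) atTop
              < ENNReal.ofReal δ) ∧
    (∀ (h : ∀ n, NoisyNet.BoolFn n) (T : ℕ → ℕ), (∀ n, 1 ≤ T n) →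
      (NoisyNet.SharpThreshold h ∨
        ∀ᶠ n : ℕ in atTop, (Real.log n) ^ (1 / 4 : ℝ) ≤ (T n : ℝ)) →
      NoisyNet.AnnealedNoiseStable (fun n => NoisyNet.functionLaw n (ρ n) (T n) (h n)) ∧
      NoisyNet.QuenchedNoiseStable (fun n => NoisyNet.functionLaw n (ρ n) (T n) (h n))) := by
  refine ⟨fun T hT δ hδ => ?_, fun h T hT_pos hT => ?_⟩
  · obtain ⟨r₀, hr₀, hlimsup⟩ :=
      NoisyNet.NearlyPerfectCorrelation.exists_limsup_netLaw_lt hρ_large hT hδ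
    refine ⟨min 1 r₀, by positivity, fun ε hε hε_lt => ?_⟩
    obtain ⟨hε_one, hε_r₀⟩ := lt_min_iff.1 hε_lt
    exact hlimsup (ε ^ 2 / 2) (by positivity) (by nlinarith)
  · have annealed :
        NoisyNet.AnnealedNoiseStable fun n => NoisyNet.functionLaw n (ρ n) (T n) (h n) :=
      hT.elim
        (fun hh => NoisyNet.NearlyPerfectCorrelation.annealedNoiseStable_of_sharpThreshold
          hρ_large hh hT_pos)
        (NoisyNet.NearlyPerfectCorrelation.annealedNoiseStable_of_log_rpow_le hρ_large h)
    exact ⟨annealed, annealed.quenchedNoiseStable⟩
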